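/- There are a deterministic algorithm and a constant $c$ such that the following holds. Given a finite set $X$ of $n=|X|$ integers, as a list of its elements in any order without repetition, and an integer $k\ge 0$, the algorithm halts after at most $c\cdot 2^{ck}\,(n+1)^{c}$ steps (that is, it runs in time $2^{O(k)}n^{O(1)}$) and correctly decides whether $X$ can be covered by at most $|X|/2-k$ arithmetic progressions, i.e. whether $X$ is the union of $m$ arithmetic progressions for some integer $m\ge 0$ with $m\le |X|/2-k$. Here an arithmetic progression is a finite set $\{a,a+d,a+2d,\dots,a+xd\}$ with $a,d\in\mathbb{Z}$ and an integer $x\ge 0$. The algorithm is a program for a random access machine with integer registers and an integer memory with indirect addressing, in which reading, writing, addition, subtraction and comparison of integers cost one step each (there is no multiplication). -/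

import Mathlib

/-! ### Arithmetic progressions and covers -/

/-- A set of integers is an arithmetic progression if it consists of the terms
`a, a + d, a + 2d, …, a + xd` for some integers `a`, `d` and some natural number `x`. -/
def IsAP (s : Set ℤ) : Prop :=
  ∃ (a d : ℤ) (x : ℕ), s = {z | ∃ i : ℕ, i ≤ x ∧ z = a + i * d}

/-- `X` is the union of `m` arithmetic progressions
(so each of them consists of elements of `X` only). -/
def CoveredByAPs (X : Finset ℤ) (m : ℕ) : Prop :=
  ∃ s : Fin m → Set ℤ, (∀ i, IsAP (s i)) ∧ (⋃ i, s i) = (X : Set ℤ)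

/-- `X` can be covered by at most `|X| / 2 - k` arithmetic progressions
(rational division and subtraction). -/
def CoverableBelow (X : Finset ℤ) (k : ℕ) : Prop :=
  ∃ m : ℕ, (m : ℚ) ≤ (X.card : ℚ) / 2 - (k : ℚ) ∧ CoveredByAPs X m

/-! ### The machine model

A deterministic random access machine with integer registers and an integer memory with indirect
addressing. Addition, subtraction, comparison, reading and writing have unit cost. There is no
multiplication, so in each operation the length of the numbers grows by at most one bit. -/

namespace RAM

/-- A configuration: the contents of the registers and of the memory cells. -/
structure State where
  reg : ℕ → ℤ
  mem : ℤ → ℤ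

/-- Expressions: integer constants, registers, memory cells, sums and differences. -/
inductive Expr : Type
  | const (z : ℤ) : Expr
  | reg (i : ℕ) : Expr
  | mem (e : Expr) : Expr
  | add (e f : Expr) : Expr
  | sub (e f : Expr) : Expr

/-- The value of an expression. -/
def Expr.eval (σ : State) : Expr → ℤ
  | .const z => z
  | .reg i => σ.reg i
  | .mem e => σ.mem (e.eval σ)
  | .add e f => e.eval σ + f.eval σ
  | .sub e f => e.eval σ - f.eval σ

/-- The cost of evaluating an expression: the number of its operations and operands. -/
def Expr.cost : Expr → ℕ
  | .const _ => 1
  | .reg _ => 1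
  | .mem e => e.cost + 1
  | .add e f => e.cost + f.cost + 1
  | .sub e f => e.cost + f.cost + 1

/-- Programs. `ite e p q` tests whether the value of `e` is positive; `loop e p` repeats `p`
as long as the value of `e` is positive. -/
inductive Prog : Type
  | skip : Prog
  | setReg (i : ℕ) (e : Expr) : Prog
  | setMem (a e : Expr) : Prog
  | seq (p q : Prog) : Prog
  | ite (e : Expr) (p q : Prog) : Prog
  | loop (e : Expr) (p : Prog) : Prog

/-- `Runs p σ T τ`: started in the configuration `σ`, the program `p` halts after exactly `T` steps
in the configuration `τ`. -/
inductive Runs : Prog → State → ℕ → State → Prop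
  | skip (σ : State) : Runs .skip σ 1 σ
  | setReg (σ : State) (i : ℕ) (e : Expr) :
      Runs (.setReg i e) σ (e.cost + 1) ⟨Function.update σ.reg i (e.eval σ), σ.mem⟩
  | setMem (σ : State) (a e : Expr) :
      Runs (.setMem a e) σ (a.cost + e.cost + 1)
        ⟨σ.reg, Function.update σ.mem (a.eval σ) (e.eval σ)⟩
  | seq {p q : Prog} {σ τ ρ : State} {S T : ℕ} :
      Runs p σ S τ → Runs q τ T ρ → Runs (.seq p q) σ (S + T) ρ
  | ite_pos {e : Expr} {p q : Prog} {σ τ : State} {T : ℕ} :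
      0 < e.eval σ → Runs p σ T τ → Runs (.ite e p q) σ (e.cost + 1 + T) τ
  | ite_neg {e : Expr} {p q : Prog} {σ τ : State} {T : ℕ} :
      e.eval σ ≤ 0 → Runs q σ T τ → Runs (.ite e p q) σ (e.cost + 1 + T) τ
  | loop_stop {e : Expr} {p : Prog} {σ : State} :
      e.eval σ ≤ 0 → Runs (.loop e p) σ (e.cost + 1) σ
  | loop_step {e : Expr} {p : Prog} {σ τ ρ : State} {S T : ℕ} :
      0 < e.eval σ → Runs p σ S τ → Runs (.loop e p) τ T ρ →
      Runs (.loop e p) σ (e.cost + 1 + S + T) ρ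

/-- The machine is deterministic: a program has at most one halting run from a configuration. -/
theorem Runs.unique {p : Prog} {σ τ τ' : State} {T T' : ℕ}
    (h : Runs p σ T τ) (h' : Runs p σ T' τ') : T = T' ∧ τ = τ' := by
  induction h generalizing T' τ' with
  | skip => cases h'; exact ⟨rfl, rfl⟩
  | setReg => cases h'; exact ⟨rfl, rfl⟩
  | setMem => cases h'; exact ⟨rfl, rfl⟩
  | seq _ _ ih1 ih2 =>
    cases h' with
    | seq a b =>
      obtain ⟨rfl, rfl⟩ := ih1 a
      obtain ⟨rfl, rfl⟩ := ih2 b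
      exact ⟨rfl, rfl⟩
  | ite_pos h _ ih =>
    cases h' with
    | ite_pos _ a => obtain ⟨rfl, rfl⟩ := ih a; exact ⟨rfl, rfl⟩
    | ite_neg g _ => omega
  | ite_neg h _ ih =>
    cases h' with
    | ite_pos g _ => omega
    | ite_neg _ a => obtain ⟨rfl, rfl⟩ := ih a; exact ⟨rfl, rfl⟩
  | loop_stop h =>
    cases h' with
    | loop_stop => exact ⟨rfl, rfl⟩
    | loop_step g _ _ => omega
  | loop_step h _ _ ih1 ih2 =>
    cases h' with
    | loop_stop g => omega
    | loop_step _ a b =>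
      obtain ⟨rfl, rfl⟩ := ih1 a
      obtain ⟨rfl, rfl⟩ := ih2 b
      exact ⟨rfl, rfl⟩

/-- The initial configuration for the input `(l, k)`: register `0` holds the length `n` of the
list `l`, register `1` holds `k`, the memory cells `0, …, n - 1` hold the entries of `l`, and
everything else is `0`. -/
def init (l : List ℤ) (k : ℕ) : State where
  reg i := if i = 0 then (l.length : ℤ) else if i = 1 then (k : ℤ) else 0
  mem a := if 0 ≤ a then l.getD a.toNat 0 else 0

end RAM

/-! Let `n = |X|` and `g = 2k + (n mod 2)`. Any two integers form a progression, so elements left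
over from a partial cover can be covered in pairs. What counts is therefore the gain `|W| - 2r` of
`r` progressions inside `X` from whose union a set `W` is selected. A cover with at most `n/2 - k`
progressions exists iff, for some `r ≤ g`, there are `r` progressions inside `X` with `g + 2r`
distinct selected elements (`coverableBelow_iff`). To get these from a cover, assign to each
progression only its newly covered elements, drop it if there are at most two, and cut off surplus
gain at the end; each progression kept has gain at least one, whence `r ≤ g`
(`exists_disjoint_of_cover`).

It remains to find `s = g + 2r` distinct elements. Walking along a progression given by its first
two terms, and taking or skipping each term, `r` rounds generate a family of index sequences
(`extend`, `extend_sound`, `extend_complete`); the question is whether one of them has length `s`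
and no repetition. The family is too large to be stored, so only a linear image of its formal sum is
kept. The index `e` goes to the vector `(e^(s-1), …, e, 1)`, a sequence to the exterior product `ω`
of its vectors, and the formal sum to the sum of the tensors `ω ⊗ ω`, an array of `2^(2s)` integers.
Prepending an index is a linear map on such arrays (`wedge_wedge_value`). The top coordinate of `ω`
is a Vandermonde determinant up to sign, nonzero exactly for `s` distinct indices
(`minor_range_ne_zero_iff`); the doubling turns it into a square, so that different sequences cannot
cancel (`value_full`).

Since `s ≤ 3g ≤ 6k + 3`, an array has at most `2^(12k+6)` entries, and the nested loops of the
program give a fixed power of this size times `n + 1`. -/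

namespace RAM

/-! ### Cost calculus for programs -/

/-- The program `p`, started in `σ`, halts within `K * (Z + 1) ^ e` steps in a configuration
that satisfies `Q`. -/
def Wp (Z K e : ℕ) (p : Prog) (σ : State) (Q : State → Prop) : Prop :=
  ∃ t τ, Runs p σ t τ ∧ t ≤ K * (Z + 1) ^ e ∧ Q τ

/-- The registers below `c` agree. -/
def Frame (c : ℕ) (σ τ : State) : Prop := ∀ i < c, τ.reg i = σ.reg i

theorem Frame.refl (c : ℕ) (σ : State) : Frame c σ σ := fun _ _ => rfl

theorem Frame.trans {c : ℕ} {σ τ ρ : State} (h : Frame c σ τ) (h' : Frame c τ ρ) :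
    Frame c σ ρ := fun i hi => (h' i hi).trans (h i hi)

theorem Frame.mono {c c' : ℕ} {σ τ : State} (h : Frame c σ τ) (hc : c' ≤ c) : Frame c' σ τ :=
  fun i hi => h i (hi.trans_le hc)

theorem Frame.update {c i : ℕ} {σ τ : State} (h : Frame c σ τ) (hc : c ≤ i) (v : ℤ)
    (m : ℤ → ℤ) : Frame c σ ⟨Function.update τ.reg i v, m⟩ := by
  intro j hj
  have : j ≠ i := by omega
  simpa [Function.update_of_ne this] using h j hj

theorem Frame.mem {c : ℕ} {σ τ : State} (h : Frame c σ τ) (m : ℤ → ℤ) :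
    Frame c σ ⟨τ.reg, m⟩ := h

namespace Wp

variable {Z : ℕ}

theorem mono {K K' e e' : ℕ} {p : Prog} {σ : State} {Q Q' : State → Prop}
    (h : Wp Z K e p σ Q) (hK : K ≤ K') (he : e ≤ e') (hQ : ∀ τ, Q τ → Q' τ) :
    Wp Z K' e' p σ Q' := by
  obtain ⟨t, τ, hr, ht, hq⟩ := h
  exact ⟨t, τ, hr, ht.trans (Nat.mul_le_mul hK (Nat.pow_le_pow_right (by omega) he)), hQ _ hq⟩

theorem seq {K₁ K₂ K e : ℕ} {p q : Prog} {σ : State} {Q : State → Prop}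
    (h : Wp Z K₁ e p σ (fun τ => Wp Z K₂ e q τ Q)) (hK : K₁ + K₂ ≤ K) :
    Wp Z K e (.seq p q) σ Q := by
  obtain ⟨t, τ, hr, ht, t', ρ, hr', ht', hq⟩ := h
  refine ⟨t + t', ρ, .seq hr hr', ?_, hq⟩
  calc t + t' ≤ (K₁ + K₂) * (Z + 1) ^ e := by rw [add_mul]; omega
    _ ≤ _ := Nat.mul_le_mul_right _ hK

theorem const_le {a K e : ℕ} (h : a ≤ K) : a ≤ K * (Z + 1) ^ e :=
  h.trans (Nat.le_mul_of_pos_right _ (by positivity))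

theorem skip {K e : ℕ} {σ : State} {Q : State → Prop} (hK : 1 ≤ K) (h : Q σ) :
    Wp Z K e .skip σ Q := ⟨_, _, .skip σ, const_le hK, h⟩

theorem setReg {K e i : ℕ} {E : Expr} {σ : State} {Q : State → Prop} (hK : E.cost + 1 ≤ K)
    (h : Q ⟨Function.update σ.reg i (E.eval σ), σ.mem⟩) : Wp Z K e (.setReg i E) σ Q :=
  ⟨_, _, .setReg σ i E, const_le hK, h⟩

theorem setMem {K e : ℕ} {A E : Expr} {σ : State} {Q : State → Prop}
    (hK : A.cost + E.cost + 1 ≤ K)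
    (h : Q ⟨σ.reg, Function.update σ.mem (A.eval σ) (E.eval σ)⟩) :
    Wp Z K e (.setMem A E) σ Q :=
  ⟨_, _, .setMem σ A E, const_le hK, h⟩

theorem ite {K K' e : ℕ} {E : Expr} {p q : Prog} {σ : State} {Q : State → Prop}
    (hK : E.cost + 1 + K ≤ K')
    (hp : 0 < E.eval σ → Wp Z K e p σ Q) (hq : E.eval σ ≤ 0 → Wp Z K e q σ Q) :
    Wp Z K' e (.ite E p q) σ Q := by
  have key : ∀ t, t ≤ K * (Z + 1) ^ e → E.cost + 1 + t ≤ K' * (Z + 1) ^ e := by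
    intro t ht
    have h1 : E.cost + 1 ≤ (E.cost + 1) * (Z + 1) ^ e := const_le le_rfl
    calc _ ≤ (E.cost + 1 + K) * (Z + 1) ^ e := by rw [add_mul _ K]; omega
      _ ≤ _ := Nat.mul_le_mul_right _ hK
  rcases lt_or_ge 0 (E.eval σ) with h | h
  · obtain ⟨t, τ, hr, ht, hQ⟩ := hp h
    exact ⟨_, τ, .ite_pos h hr, key t ht, hQ⟩
  · obtain ⟨t, τ, hr, ht, hQ⟩ := hq h
    exact ⟨_, τ, .ite_neg h hr, key t ht, hQ⟩

end Wp

/-- `for i from 0 to h - 1 do body`, where `i` and `h` are registers. -/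
def forReg (i h : ℕ) (body : Prog) : Prog :=
  .seq (.setReg i (.const 0))
    (.loop (.sub (.reg h) (.reg i)) (.seq body (.setReg i (.add (.reg i) (.const 1)))))

/-- Each level of nesting costs one factor `Z + 1`, where `Z + 1` bounds all loop lengths. Inner
loops use larger register numbers than outer ones, so the frame condition protects the counter `i`
and the bound `h < i`. In the constant, 8 pays for the test and the increment of a round, 6 for the
initialization and the last test. -/
theorem Wp.forReg {Z K K' e i h N : ℕ} {body : Prog} {σ : State} (J : ℕ → State → Prop)
    (hi : h < i) (hN : σ.reg h = N) (hNZ : N ≤ Z + 1) (hK : K + 14 ≤ K')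
    (h0 : J 0 ⟨Function.update σ.reg i 0, σ.mem⟩)
    (hstep : ∀ j < N, ∀ τ, Frame i σ τ → τ.reg i = j → J j τ →
      Wp Z K e body τ (fun ρ => Frame (i + 1) τ ρ ∧
        J (j + 1) ⟨Function.update ρ.reg i ((j : ℤ) + 1), ρ.mem⟩)) :
    Wp Z K' (e + 1) (RAM.forReg i h body) σ (fun τ => Frame i σ τ ∧ J N τ) := by
  have main : ∀ d j τ, j + d = N → Frame i σ τ → τ.reg i = j → J j τ →
      ∃ t ρ, Runs (.loop (.sub (.reg h) (.reg i))
        (.seq body (.setReg i (.add (.reg i) (.const 1))))) τ t ρ ∧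
        t ≤ d * (K * (Z + 1) ^ e + 8) + 4 ∧ Frame i σ ρ ∧ J N ρ := by
    intro d
    induction d with
    | zero =>
      intro j τ hj hf hr hJ
      refine ⟨_, τ, Runs.loop_stop ?_, ?_, hf, ?_⟩
      · simp only [Expr.eval, hf h hi, hN, hr]; omega
      · simp [Expr.cost]
      · have : j = N := by omega
        exact this ▸ hJ
    | succ d ih =>
      intro j τ hj hf hr hJ
      obtain ⟨t, ρ, hρ, ht, hfr, hJ'⟩ := hstep j (by omega) τ hf hr hJ
      have hri : ρ.reg i = j := (hfr i (by omega)).trans hr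
      obtain ⟨t', ρ', hρ', ht', hf', hJ''⟩ := ih (j + 1)
        ⟨Function.update ρ.reg i ((j : ℤ) + 1), ρ.mem⟩ (by omega)
        ((hf.trans (hfr.mono (by omega))).update le_rfl _ _) (by simp) hJ'
      have hset := Runs.setReg ρ i (.add (.reg i) (.const 1))
      simp only [Expr.eval, hri] at hset
      refine ⟨_, ρ', .loop_step ?_ (.seq hρ hset) hρ', ?_, hf', hJ''⟩
      · simp only [Expr.eval, hf h hi, hN, hr]; omega
      · simp only [Expr.cost]; rw [add_mul, one_mul]; omega
  obtain ⟨t, ρ, hρ, ht, hf, hJ⟩ := main N 0 ⟨Function.update σ.reg i 0, σ.mem⟩ (by omega)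
    ((Frame.refl i σ).update le_rfl _ _) (by simp) h0
  refine ⟨_, ρ, .seq (Runs.setReg σ i (.const 0)) hρ, ?_, hf, hJ⟩
  have h1 : 1 ≤ (Z + 1) ^ e := Nat.one_le_pow _ _ (by omega)
  have h2 : 1 ≤ (Z + 1) ^ (e + 1) := Nat.one_le_pow _ _ (by omega)
  have h3 : N * (K * (Z + 1) ^ e + 8) ≤ (K + 8) * (Z + 1) ^ (e + 1) := by
    calc _ ≤ (Z + 1) * (K * (Z + 1) ^ e + 8 * (Z + 1) ^ e) := Nat.mul_le_mul hNZ (by omega)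
      _ = _ := by ring
  simp only [Expr.cost]
  calc _ ≤ (K + 8) * (Z + 1) ^ (e + 1) + 6 * (Z + 1) ^ (e + 1) := by omega
    _ = (K + 14) * (Z + 1) ^ (e + 1) := by ring
    _ ≤ _ := Nat.mul_le_mul_right _ hK

end RAM

/-! ### Minors and the Vandermonde determinant -/

open Finset in
/-- The minor, with columns `A`, of the matrix whose rows are the vectors
`(e ^ (s - 1), …, e, 1)` for `e` in the list, by Laplace expansion. -/
def minor (s : ℕ) : Finset ℕ → List ℕ → ℤ
  | A, [] => if A = ∅ then 1 else 0
  | A, e :: q => ∑ a ∈ A, (e : ℤ) ^ (s - 1 - a) * (-1) ^ #{b ∈ A | b < a} * minor s (A.erase a) q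

theorem minor_eq_zero_of_card_ne {s : ℕ} (q : List ℕ) :
    ∀ A : Finset ℕ, A.card ≠ q.length → minor s A q = 0 := by
  induction q with
  | nil => intro A h; simp [minor]; rintro rfl; simp at h
  | cons e q ih =>
    intro A h
    simp only [minor]
    refine Finset.sum_eq_zero fun a ha => ?_
    rw [ih, mul_zero]
    rw [Finset.card_erase_of_mem ha]
    have := Finset.card_pos.mpr ⟨a, ha⟩
    simp at h
    omega

/-- Both sides satisfy the same Laplace expansion along the first row: the number of columns of `A`
below `c j` is `j`, and erasing `c j` corresponds to composing with `succAbove`. -/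
theorem minor_map_eq_det {s : ℕ} : ∀ (q : List ℕ) (c : Fin q.length ↪o ℕ),
    minor s (Finset.univ.map c.toEmbedding) q =
      (Matrix.of fun i j : Fin q.length => (q.get i : ℤ) ^ (s - 1 - c j)).det := by
  intro q
  induction q with
  | nil => intro c; simp [minor]
  | cons e q ih =>
    intro c
    rw [Matrix.det_succ_row_zero]
    simp only [minor, Finset.sum_map]
    refine Finset.sum_congr rfl fun j _ => ?_
    have hcard : (Finset.filter (fun b => b < c j)
        (Finset.univ.map c.toEmbedding)).card = (j : ℕ) := by
      rw [Finset.filter_map, Finset.card_map]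
      have : (Finset.univ.filter ((fun b => b < c j) ∘ c.toEmbedding)) = Finset.Iio j := by
        ext i; simp
      rw [this]; simp
    have herase : (Finset.univ.map c.toEmbedding).erase (c j) =
        Finset.univ.map ((Fin.succAboveOrderEmb j).trans c).toEmbedding := by
      ext x
      simp only [Finset.mem_erase, Finset.mem_map, Finset.mem_univ, true_and]
      constructor
      · rintro ⟨hx, i, rfl⟩
        have : i ≠ j := fun h => hx (by simp [h])
        obtain ⟨i', rfl⟩ := Fin.exists_succAbove_eq this
        exact ⟨i', rfl⟩
      · rintro ⟨i, rfl⟩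
        exact ⟨fun h => Fin.succAbove_ne j i (c.injective h), _, rfl⟩
    have := ih ((Fin.succAboveOrderEmb j).trans c)
    simp only [RelEmbedding.coe_toEmbedding] at *
    rw [hcard, herase, this]
    have : ((Matrix.of fun i j => ((e :: q).get i : ℤ) ^ (s - 1 - c j)).submatrix Fin.succ
        j.succAbove) = Matrix.of fun i j' : Fin q.length =>
          (q.get i : ℤ) ^ (s - 1 - ((Fin.succAboveOrderEmb j).trans c) j') := by
      ext i j'; simp
    rw [this]
    simp only [Matrix.of_apply, List.get_cons_zero]
    ring

theorem minor_range_ne_zero_iff {s : ℕ} (q : List ℕ) :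
    minor s (Finset.range s) q ≠ 0 ↔ q.Nodup ∧ q.length = s := by
  by_cases hs : q.length = s
  · subst hs
    have h := minor_map_eq_det (s := q.length) q (Fin.valOrderEmb _)
    have hr : Finset.univ.map (Fin.valOrderEmb q.length).toEmbedding
        = Finset.range q.length := by
      ext x; simp only [Finset.mem_map, Finset.mem_univ, true_and, Finset.mem_range]
      constructor
      · rintro ⟨i, rfl⟩; exact i.2
      · intro hx; exact ⟨⟨x, hx⟩, rfl⟩
    rw [hr] at h
    -- The powers decrease from left to right, so this is the Vandermonde matrix with its columns
    -- reversed.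
    have hm : (Matrix.of fun i j : Fin q.length => (q.get i : ℤ) ^ (q.length - 1 -
        (Fin.valOrderEmb q.length) j)) =
        (Matrix.vandermonde fun i => (q.get i : ℤ)).submatrix id Fin.revPerm := by
      ext i j
      simp only [Matrix.of_apply, Matrix.submatrix_apply, Matrix.vandermonde_apply, id,
        Fin.revPerm_apply, Fin.val_rev, Fin.valOrderEmb_apply]
      congr 1; omega
    rw [h, hm, Matrix.det_permute', mul_ne_zero_iff, Matrix.det_vandermonde_ne_zero_iff]
    simp only [ne_eq, Int.cast_eq_zero, Units.ne_zero, not_false_eq_true, true_and, and_true]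
    rw [List.nodup_iff_injective_get]
    exact Nat.cast_injective.of_comp_iff _
  · simp only [hs, and_false, iff_false, not_not]
    exact minor_eq_zero_of_card_ne q _ (by simpa using Ne.symm hs)

/-! ### Exterior products on arrays indexed by bit masks -/

/-- The positions `a < s` such that the bit `o + a` of `m` is set. -/
def bitSet (s o m : ℕ) : Finset ℕ := {a ∈ Finset.range s | m.testBit (o + a)}

theorem testBit_sub_two_pow {m a b : ℕ} (h : m.testBit a) :
    (m - 2 ^ a).testBit b = (m.testBit b && decide (b ≠ a)) := by
  have hlt : m % 2 ^ a < 2 ^ a := Nat.mod_lt _ (by positivity)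
  have hm := Nat.div_add_mod m (2 ^ a)
  have hodd : m / 2 ^ a % 2 = 1 := by simpa [Nat.testBit_eq_decide_div_mod_eq] using h
  obtain ⟨c, hc⟩ : ∃ c, m / 2 ^ a = 2 * c + 1 := ⟨m / 2 ^ a / 2, by omega⟩
  have h1 : m = 2 ^ a * (2 * c + 1) + m % 2 ^ a := by rw [← hc]; exact hm.symm
  have h2 : m - 2 ^ a = 2 ^ a * (2 * c) + m % 2 ^ a := by
    have : 2 ^ a * (2 * c + 1) = 2 ^ a * (2 * c) + 2 ^ a := by ring
    omega
  rw [h2]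
  conv_rhs => rw [h1]
  rw [Nat.testBit_two_pow_mul_add _ hlt, Nat.testBit_two_pow_mul_add _ hlt]
  rcases lt_trichotomy b a with hb | rfl | hb
  · simp [hb, hb.ne]
  · simp
  · obtain ⟨d, rfl⟩ := Nat.exists_eq_add_of_lt hb
    have h3 : a + d + 1 - a = d + 1 := by omega
    simp only [hb.not_gt, if_false, h3, Nat.testBit_succ]
    have h4 : (2 * c + 1) / 2 = c := by omega
    have h5 : 2 * c / 2 = c := by omega
    simp [h4, h5]; omega

/-- One sweep over the bits `o, …, o + j - 1`. -/
def wedge (o e : ℕ) (f : ℕ → ℤ) : ℕ → ℕ → ℤ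
  | 0, _ => 0
  | j + 1, m => e * wedge o e f j m +
      if m.testBit (o + j) then (-1) ^ (bitSet j o m).card * f (m - 2 ^ (o + j)) else 0

/-- Horner's rule: the term created at bit `a` is multiplied by `e` at every later bit, so no powers
of `e` have to be stored. -/
theorem wedge_eq_sum (o e : ℕ) (f : ℕ → ℤ) (j m : ℕ) :
    wedge o e f j m = ∑ a ∈ bitSet j o m,
      (e : ℤ) ^ (j - 1 - a) * (-1) ^ (bitSet a o m).card * f (m - 2 ^ (o + a)) := by
  induction j with
  | zero => simp [wedge, bitSet]
  | succ j ih =>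
    rw [wedge, ih, Finset.mul_sum]
    have : bitSet (j + 1) o m =
        if m.testBit (o + j) then insert j (bitSet j o m) else bitSet j o m := by
      simp [bitSet, Finset.range_add_one, Finset.filter_insert]
    have hs : ∑ a ∈ bitSet j o m, (e : ℤ) * ((e : ℤ) ^ (j - 1 - a) * (-1) ^ (bitSet a o m).card *
        f (m - 2 ^ (o + a))) = ∑ a ∈ bitSet j o m,
      (e : ℤ) ^ (j - a) * (-1) ^ (bitSet a o m).card * f (m - 2 ^ (o + a)) := by
      refine Finset.sum_congr rfl fun a ha => ?_
      have : a < j := by simp [bitSet] at ha; exact ha.1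
      rw [show j - a = (j - 1 - a) + 1 by omega, pow_succ]; ring
    rw [hs, this]
    split_ifs with h
    · rw [Finset.sum_insert (by simp [bitSet])]; simp; ring
    · simp

theorem wedge_add (o e : ℕ) (f g : ℕ → ℤ) (j m : ℕ) :
    wedge o e (fun m => f m + g m) j m = wedge o e f j m + wedge o e g j m := by
  simp only [wedge_eq_sum, ← Finset.sum_add_distrib, mul_add]

theorem wedge_zero (o e : ℕ) (j m : ℕ) : wedge o e (fun _ => 0) j m = 0 := by
  simp [wedge_eq_sum]

theorem wedge_congr {o e j m : ℕ} {f g : ℕ → ℤ} (h : ∀ m' ≤ m, f m' = g m') :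
    wedge o e f j m = wedge o e g j m := by
  simp only [wedge_eq_sum]
  exact Finset.sum_congr rfl fun a _ => by rw [h _ (Nat.sub_le _ _)]

/-- With the factor `h` unaffected by clearing bits of the block at `o`, this is the Laplace
expansion. In use, `h` is the minor of the other block, so the two tensor factors can be treated one
after the other. -/
theorem wedge_minor {s o e : ℕ} {q : List ℕ} (h : ℕ → ℤ) {m : ℕ}
    (hh : ∀ a ∈ bitSet s o m, h (m - 2 ^ (o + a)) = h m) :
    wedge o e (fun m => minor s (bitSet s o m) q * h m) s m =
      minor s (bitSet s o m) (e :: q) * h m := by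
  rw [wedge_eq_sum, minor, Finset.sum_mul]
  refine Finset.sum_congr rfl fun a ha => ?_
  rw [hh a ha]
  have ha' : a < s ∧ m.testBit (o + a) := by simpa [bitSet] using ha
  have h1 : bitSet s o (m - 2 ^ (o + a)) = (bitSet s o m).erase a := by
    ext b
    simp only [bitSet, Finset.mem_filter, Finset.mem_range, testBit_sub_two_pow ha'.2,
      Finset.mem_erase]
    simp; tauto
  have h2 : bitSet a o m = {b ∈ bitSet s o m | b < a} := by
    ext b
    simp only [bitSet, Finset.mem_filter, Finset.mem_range]
    constructor
    · rintro ⟨h, h'⟩; exact ⟨⟨by omega, h'⟩, h⟩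
    · rintro ⟨⟨_, h'⟩, h⟩; exact ⟨h, h'⟩
  rw [h1, h2]; ring

/-- The array that represents a formal sum of lists of indices. -/
def value (s : ℕ) (L : List (List ℕ)) (m : ℕ) : ℤ :=
  (L.map fun q => minor s (bitSet s 0 m) q * minor s (bitSet s s m) q).sum

theorem value_append (s : ℕ) (L L' : List (List ℕ)) (m : ℕ) :
    value s (L ++ L') m = value s L m + value s L' m := by simp [value]

theorem bitSet_sub_of_disjoint {s o o' a m : ℕ} (hb : m.testBit (o + a))
    (h : ∀ b < s, o' + b ≠ o + a) : bitSet s o' (m - 2 ^ (o + a)) = bitSet s o' m := by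
  ext b
  simp only [bitSet, Finset.mem_filter, Finset.mem_range, testBit_sub_two_pow hb]
  constructor
  · simp only [Bool.and_eq_true]; tauto
  · rintro ⟨h1, h2⟩; simp [h1, h2, h b h1]

theorem wedge_wedge_value (s e : ℕ) (L : List (List ℕ)) (m : ℕ) :
    wedge s e (fun m => wedge 0 e (value s L) s m) s m = value s (L.map (e :: ·)) m := by
  induction L generalizing m with
  | nil =>
    have : value s [] = fun _ => 0 := by ext; simp [value]
    simp [this, wedge_zero]
  | cons q L ih =>
    have h1 : value s (q :: L) = fun m =>
        minor s (bitSet s 0 m) q * minor s (bitSet s s m) q + value s L m := by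
      ext; simp [value]
    have h2 : ∀ m, wedge 0 e (value s (q :: L)) s m =
        minor s (bitSet s s m) q * minor s (bitSet s 0 m) (e :: q) +
          wedge 0 e (value s L) s m := by
      intro m
      rw [h1, wedge_add, wedge_minor (fun m => minor s (bitSet s s m) q), mul_comm]
      intro a ha
      have ha' : a < s ∧ m.testBit (0 + a) := by simpa [bitSet] using ha
      rw [bitSet_sub_of_disjoint ha'.2 (by intros; omega)]
    simp only [h2]
    rw [wedge_add, ih, wedge_minor (fun m => minor s (bitSet s 0 m) (e :: q))]
    · simp [value]; ring
    · intro a ha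
      have ha' : a < s ∧ m.testBit (s + a) := by simpa [bitSet] using ha
      rw [bitSet_sub_of_disjoint ha'.2 (by intros; omega)]

/-- The empty sequence is the unit of the exterior algebra. The bound on `m` matters because `value`
does not see bits from `2 * s` on. -/
theorem value_nil_singleton {s m : ℕ} (hm : m < 2 ^ (2 * s)) :
    value s [[]] m = if m = 0 then 1 else 0 := by
  have key : bitSet s 0 m = ∅ ∧ bitSet s s m = ∅ ↔ m = 0 := by
    constructor
    · rintro ⟨h1, h2⟩
      apply Nat.zero_of_testBit_eq_false
      intro i
      rw [Bool.eq_false_iff]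
      intro hi
      by_cases h : i < s
      · have : i ∈ bitSet s 0 m := by simp [bitSet, h, hi]
        simp [h1] at this
      · by_cases h' : i < 2 * s
        · have : i - s ∈ bitSet s s m := by
            simp only [bitSet, Finset.mem_filter, Finset.mem_range]
            exact ⟨by omega, by rwa [show s + (i - s) = i by omega]⟩
          simp [h2] at this
        · have := Nat.testBit_lt_two_pow
            (hm.trans_le (Nat.pow_le_pow_right (n := 2) (by omega) (not_lt.mp h')))
          simp [this] at hi
    · rintro rfl; simp [bitSet]
  simp only [value, List.map_cons, List.map_nil, List.sum_cons, List.sum_nil, minor, add_zero]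
  by_cases h : m = 0
  · obtain ⟨h1, h2⟩ := key.mpr h; rw [h1, h2]; simp [h]
  · have := mt key.mp h
    rw [if_neg h]
    by_cases h1 : bitSet s 0 m = ∅
    · have h2 : bitSet s s m ≠ ∅ := fun h2 => this ⟨h1, h2⟩
      simp [h2]
    · simp [h1]

/-- At the full mask both blocks give the same minor, so the entry is a sum of integer squares and
no cancellation can occur. -/
theorem value_full (s : ℕ) (L : List (List ℕ)) :
    0 < value s L (2 ^ (2 * s) - 1) ↔ ∃ q ∈ L, q.Nodup ∧ q.length = s := by
  have hA : ∀ o ≤ s, bitSet s o (2 ^ (2 * s) - 1) = Finset.range s := by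
    intro o ho
    ext b
    simp only [bitSet, Finset.mem_filter, Finset.mem_range, Nat.testBit_two_pow_sub_one]
    simp; omega
  simp only [value, hA 0 (Nat.zero_le _), hA s le_rfl, ← minor_range_ne_zero_iff]
  induction L with
  | nil => simp
  | cons q L ih =>
    simp only [List.map_cons, List.sum_cons, List.mem_cons, exists_eq_or_imp, ← ih]
    have hn : 0 ≤ (L.map fun q => minor s (Finset.range s) q * minor s (Finset.range s) q).sum :=
      List.sum_nonneg (by simp only [List.mem_map]; rintro _ ⟨a, -, rfl⟩; exact mul_self_nonneg _)
    have hq := mul_self_nonneg (minor s (Finset.range s) q)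
    by_cases h0 : minor s (Finset.range s) q = 0
    · simp [h0]
    · simp only [ne_eq, h0, not_false_eq_true, true_or, iff_true]
      have := mul_self_pos.mpr h0
      omega

/-! ### Unions of progressions -/

/-- `Y` is the union of `m` arithmetic progressions. -/
def IsUnionOfAPs (Y : Set ℤ) (m : ℕ) : Prop :=
  ∃ s : Fin m → Set ℤ, (∀ i, IsAP (s i)) ∧ (⋃ i, s i) = Y

theorem IsUnionOfAPs.empty : IsUnionOfAPs ∅ 0 := ⟨fun _ => ∅, fun i => i.elim0, by simp⟩

theorem IsAP.isUnionOfAPs {Y : Set ℤ} (h : IsAP Y) : IsUnionOfAPs Y 1 :=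
  ⟨fun _ => Y, fun _ => h, Set.iUnion_const _⟩

theorem IsUnionOfAPs.union {Y Y' : Set ℤ} {m m' : ℕ} (h : IsUnionOfAPs Y m)
    (h' : IsUnionOfAPs Y' m') : IsUnionOfAPs (Y ∪ Y') (m + m') := by
  obtain ⟨s, hs, rfl⟩ := h
  obtain ⟨s', hs', rfl⟩ := h'
  refine ⟨Fin.append s s', fun i => ?_, ?_⟩
  · induction i using Fin.addCases with
    | left i => simpa using hs i
    | right i => simpa using hs' i
  · ext x
    simp only [Set.mem_iUnion, Set.mem_union]
    constructor
    · rintro ⟨i, hi⟩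
      induction i using Fin.addCases with
      | left i => exact .inl ⟨i, by simpa using hi⟩
      | right i => exact .inr ⟨i, by simpa using hi⟩
    · rintro (⟨i, hi⟩ | ⟨i, hi⟩)
      · exact ⟨Fin.castAdd _ i, by simpa using hi⟩
      · exact ⟨Fin.natAdd _ i, by simpa using hi⟩

theorem isAP_pair (a b : ℤ) : IsAP {a, b} := by
  refine ⟨a, b - a, 1, ?_⟩
  ext z
  simp only [Set.mem_insert_iff, Set.mem_singleton_iff, Set.mem_ofPred_eq]
  constructor
  · rintro (rfl | rfl)
    · exact ⟨0, by simp⟩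
    · exact ⟨1, by simp⟩
  · rintro ⟨i, hi, rfl⟩
    interval_cases i <;> simp

theorem isUnionOfAPs_of_card_eq (h : ℕ) : ∀ Y : Finset ℤ, Y.card = 2 * h →
    IsUnionOfAPs (Y : Set ℤ) h := by
  induction h with
  | zero =>
    intro Y hY
    obtain rfl := Finset.card_eq_zero.mp (hY.trans (mul_zero 2))
    simpa using IsUnionOfAPs.empty
  | succ h ih =>
    intro Y hY
    obtain ⟨P, hP, hc⟩ := Finset.exists_subset_card_eq (s := Y) (n := 2) (by omega)
    obtain ⟨a, b, -, rfl⟩ := Finset.card_eq_two.mp hc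
    have h1 := ih (Y \ {a, b}) (by rw [Finset.card_sdiff_of_subset hP]; omega)
    have h2 := h1.union (isAP_pair a b).isUnionOfAPs
    have : ((Y \ {a, b} : Finset ℤ) : Set ℤ) ∪ {a, b} = (Y : Set ℤ) := by
      rw [← Finset.sdiff_union_of_subset hP]; push_cast; simp
    rwa [this] at h2

/-! ### Index sequences picked along progressions -/

/-- One step along a progression with difference `d`: each of the lists of indices may be
extended by the index of the current element. -/
def runStep (l : List ℤ) (d : ℤ) (p : ℤ × List (List ℕ)) : ℤ × List (List ℕ) :=
  if l.idxOf p.1 < l.length then (p.1 + d, p.2 ++ p.2.map (l.idxOf p.1 :: ·)) else p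

/-- The lists in `L`, extended by elements of the progression from `a` with difference `d`. -/
def extendAlong (l : List ℤ) (d a : ℤ) (L : List (List ℕ)) : List (List ℕ) :=
  ((runStep l d)^[l.length] (a, L)).2

/-- The lists in `L`, extended in all ways by elements of one progression. -/
def extend (l : List ℤ) (L : List (List ℕ)) : List (List ℕ) :=
  (List.range l.length).flatMap fun i => (List.range l.length).flatMap fun j =>
    extendAlong l (l.getD j 0 - l.getD i 0) (l.getD i 0) L

/-- `T` counts the steps that really move; it may be smaller than `t`, since the walk freezes once
it leaves `l`. -/
theorem runStep_sound (l : List ℤ) (d a : ℤ) (L : List (List ℕ)) (t : ℕ) :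
    ∃ T : ℕ, ((runStep l d)^[t] (a, L)).1 = a + T * d ∧ (∀ i < T, a + (i : ℕ) * d ∈ l) ∧
      ∀ q ∈ ((runStep l d)^[t] (a, L)).2, ∃ p q₀, q = p ++ q₀ ∧ q₀ ∈ L ∧
        ∀ e ∈ p, e < l.length ∧ ∃ i < T, l.getD e 0 = a + (i : ℕ) * d := by
  induction t with
  | zero => exact ⟨0, by simp, by simp, fun q hq => ⟨[], q, by simp, hq, by simp⟩⟩
  | succ t ih =>
    obtain ⟨T, h1, h2, h3⟩ := ih
    rw [Function.iterate_succ_apply']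
    set P := (runStep l d)^[t] (a, L)
    unfold runStep
    split_ifs with h
    · have hmem : P.1 ∈ l := List.idxOf_lt_length_iff.mp h
      refine ⟨T + 1, by simp [h1]; ring, fun i hi => ?_, fun q hq => ?_⟩
      · rcases Nat.lt_succ_iff_lt_or_eq.mp hi with hi | rfl
        · exact h2 i hi
        · exact h1 ▸ hmem
      · rcases List.mem_append.mp hq with hq | hq
        · obtain ⟨p, q₀, rfl, hq₀, hp⟩ := h3 q hq
          exact ⟨p, q₀, rfl, hq₀, fun e he =>
            ⟨(hp e he).1, by obtain ⟨i, hi, h⟩ := (hp e he).2; exact ⟨i, by omega, h⟩⟩⟩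
        · obtain ⟨q', hq', rfl⟩ := List.mem_map.mp hq
          obtain ⟨p, q₀, rfl, hq₀, hp⟩ := h3 q' hq'
          refine ⟨l.idxOf P.1 :: p, q₀, rfl, hq₀, fun e he => ?_⟩
          rcases List.mem_cons.mp he with rfl | he
          · refine ⟨h, T, by omega, ?_⟩
            rw [← h1, List.getD_eq_getElem _ _ h, List.getElem_idxOf]
          · exact ⟨(hp e he).1, by obtain ⟨i, hi, h⟩ := (hp e he).2; exact ⟨i, by omega, h⟩⟩
    · exact ⟨T, h1, h2, h3⟩

theorem extend_sound {l : List ℤ} (r : ℕ) : ∀ q ∈ (extend l)^[r] [[]],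
    ∃ Y : Set ℤ, IsUnionOfAPs Y r ∧ Y ⊆ {z | z ∈ l} ∧
      ∀ e ∈ q, e < l.length ∧ l.getD e 0 ∈ Y := by
  induction r with
  | zero => intro q hq; exact ⟨∅, .empty, by simp, by simp_all⟩
  | succ r ih =>
    intro q hq
    rw [Function.iterate_succ_apply'] at hq
    simp only [extend, List.mem_flatMap, List.mem_range] at hq
    obtain ⟨i, hi, j, hj, hq⟩ := hq
    obtain ⟨T, -, h2, h3⟩ := runStep_sound l (l.getD j 0 - l.getD i 0) (l.getD i 0)
      ((extend l)^[r] [[]]) l.length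
    obtain ⟨p, q₀, rfl, hq₀, hp⟩ := h3 q hq
    obtain ⟨Y, hY, hYl, hqY⟩ := ih q₀ hq₀
    set a := l.getD i 0 with ha
    set d := l.getD j 0 - a
    have hal : a ∈ l := by rw [ha, List.getD_eq_getElem _ _ hi]; exact List.getElem_mem hi
    -- For `T = 0` the truncated `T - 1` would still give the progression `{a}`, which lies in `l`;
    -- hence `T > 0` need not be shown.
    refine ⟨Y ∪ {z | ∃ i : ℕ, i ≤ T - 1 ∧ z = a + i * d},
      hY.union (IsAP.isUnionOfAPs ⟨a, d, T - 1, rfl⟩), ?_, ?_⟩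
    · rintro z (hz | ⟨i, hi, rfl⟩)
      · exact hYl hz
      · rcases Nat.eq_zero_or_pos i with rfl | h0
        · simpa using hal
        · exact h2 i (by omega)
    · intro e he
      rcases List.mem_append.mp he with he | he
      · obtain ⟨h4, i, hi, h5⟩ := hp e he
        exact ⟨h4, .inr ⟨i, by omega, h5⟩⟩
      · exact ⟨(hqY e he).1, .inl (hqY e he).2⟩

/-- At each term follow the branch that takes it iff it belongs to `S`. As `d ≠ 0`, the terms are
distinct and none is taken twice. -/
theorem runStep_complete {l : List ℤ} {d a : ℤ} (hd : d ≠ 0) {x : ℕ}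
    (hx : ∀ i ≤ x, a + (i : ℕ) * d ∈ l) (S : Finset ℤ) {L : List (List ℕ)} {q : List ℕ}
    (hq : q ∈ L) (t : ℕ) (ht : t ≤ x + 1) :
    ((runStep l d)^[t] (a, L)).1 = a + t * d ∧
      ∃ p, p ++ q ∈ ((runStep l d)^[t] (a, L)).2 ∧ (p.map (l.getD · 0)).Nodup ∧
        ∀ z, z ∈ p.map (l.getD · 0) ↔ z ∈ S ∧ ∃ i < t, z = a + (i : ℕ) * d := by
  induction t with
  | zero => exact ⟨by simp, [], by simpa using hq, by simp, by simp⟩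
  | succ t ih =>
    obtain ⟨h1, p, h2, h3, h4⟩ := ih (by omega)
    rw [Function.iterate_succ_apply']
    set P := (runStep l d)^[t] (a, L)
    have hmem : P.1 ∈ l := by rw [h1]; exact hx t (by omega)
    have hidx := List.idxOf_lt_length_iff.mpr hmem
    have hget : l.getD (l.idxOf P.1) 0 = a + t * d := by
      rw [← h1, List.getD_eq_getElem _ _ hidx, List.getElem_idxOf]
    unfold runStep
    rw [if_pos hidx]
    refine ⟨by simp [h1]; ring, ?_⟩
    by_cases hS : a + t * d ∈ S
    · refine ⟨l.idxOf P.1 :: p, List.mem_append.mpr (.inr (List.mem_map.mpr ⟨_, h2, rfl⟩)), ?_, ?_⟩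
      · rw [List.map_cons, List.nodup_cons]
        refine ⟨?_, h3⟩
        rw [hget, h4]
        rintro ⟨-, i, hi, he⟩
        have := mul_right_cancel₀ hd (add_left_cancel he)
        omega
      · intro z
        rw [List.map_cons, List.mem_cons, hget, h4]
        constructor
        · rintro (rfl | ⟨h, i, hi, he⟩)
          · exact ⟨hS, t, by omega, rfl⟩
          · exact ⟨h, i, by omega, he⟩
        · rintro ⟨h, i, hi, he⟩
          rcases Nat.lt_succ_iff_lt_or_eq.mp hi with hi | rfl
          · exact .inr ⟨h, i, hi, he⟩
          · exact .inl he
    · refine ⟨p, List.mem_append.mpr (.inl h2), h3, fun z => ?_⟩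
      rw [h4]
      constructor
      · rintro ⟨h, i, hi, he⟩; exact ⟨h, i, by omega, he⟩
      · rintro ⟨h, i, hi, he⟩
        rcases Nat.lt_succ_iff_lt_or_eq.mp hi with hi | rfl
        · exact ⟨h, i, hi, he⟩
        · exact absurd (he ▸ h) hS

theorem subset_iterate_runStep (l : List ℤ) (d : ℤ) (P : ℤ × List (List ℕ)) (t : ℕ) :
    P.2 ⊆ ((runStep l d)^[t] P).2 := by
  induction t with
  | zero => simp
  | succ t ih =>
    rw [Function.iterate_succ_apply']
    refine List.Subset.trans ih ?_
    rw [runStep]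
    split_ifs
    · exact List.subset_append_left _ _
    · exact List.Subset.refl _

theorem extend_complete {l : List ℤ} (Ss : List (Finset ℤ)) (hdis : Ss.Pairwise Disjoint)
    (hS : ∀ S ∈ Ss, 2 ≤ S.card ∧ ∃ P : Set ℤ, IsAP P ∧ P ⊆ {z | z ∈ l} ∧ (S : Set ℤ) ⊆ P) :
    ∃ q ∈ (extend l)^[Ss.length] [[]], (q.map (l.getD · 0)).Nodup ∧
      (∀ z, z ∈ q.map (l.getD · 0) ↔ ∃ S ∈ Ss, z ∈ S) ∧
      q.length = (Ss.map Finset.card).sum := by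
  induction Ss with
  | nil => exact ⟨[], by simp⟩
  | cons S Ss ih =>
    rw [List.pairwise_cons] at hdis
    obtain ⟨q, hq, hn, hm, hlen⟩ := ih hdis.2 fun S' h => hS S' (List.mem_cons_of_mem _ h)
    obtain ⟨hc, _, ⟨a, d, x, rfl⟩, hPl, hSP⟩ := hS S List.mem_cons_self
    -- Two distinct elements of `S` force `d ≠ 0` and `x ≥ 1`, so that `a` and `a + d` both lie in
    -- `l` and the progression is among those that `extend` tries.
    have hd : d ≠ 0 := by
      rintro rfl
      obtain ⟨u, hu, v, hv, huv⟩ := Finset.one_lt_card.mp hc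
      obtain ⟨_, -, rfl⟩ := hSP hu
      obtain ⟨_, -, rfl⟩ := hSP hv
      simp at huv
    have hx : ∀ i ≤ x, a + (i : ℕ) * d ∈ l := fun i hi => hPl ⟨i, hi, rfl⟩
    have hx1 : 1 ≤ x := by
      by_contra h
      obtain ⟨u, hu, v, hv, huv⟩ := Finset.one_lt_card.mp hc
      obtain ⟨i, hi, rfl⟩ := hSP hu
      obtain ⟨j, hj, rfl⟩ := hSP hv
      have : i = j := by omega
      simp [this] at huv
    have hxl : x + 1 ≤ l.length := by
      have hinj : Function.Injective fun i : ℕ => a + (i : ℤ) * d := by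
        intro i j h
        exact Nat.cast_injective (mul_right_cancel₀ hd (add_left_cancel h))
      have : (Finset.range (x + 1)).image (fun i : ℕ => a + (i : ℤ) * d) ⊆ l.toFinset := by
        intro z hz
        obtain ⟨i, hi, rfl⟩ := Finset.mem_image.mp hz
        exact List.mem_toFinset.mpr (hx i (by simpa [Nat.lt_succ_iff] using hi))
      have := (Finset.card_le_card this).trans l.toFinset_card_le
      rwa [Finset.card_image_of_injective _ hinj, Finset.card_range] at this
    obtain ⟨-, p, hp, hpn, hpm⟩ := runStep_complete hd hx S hq (x + 1) le_rfl
    have hpm' : ∀ z, z ∈ p.map (l.getD · 0) ↔ z ∈ S := fun z => by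
      rw [hpm]
      refine ⟨And.left, fun hz => ⟨hz, ?_⟩⟩
      obtain ⟨i, hi, h⟩ := hSP hz
      exact ⟨i, by omega, h⟩
    have h0 : a ∈ l := by simpa using hx 0 (Nat.zero_le _)
    have h1 : a + d ∈ l := by simpa using hx 1 hx1
    have hget : ∀ z ∈ l, l.getD (l.idxOf z) 0 = z := fun z hz => by
      rw [List.getD_eq_getElem _ _ (List.idxOf_lt_length_iff.mpr hz), List.getElem_idxOf]
    refine ⟨p ++ q, ?_, ?_, ?_, ?_⟩
    · rw [List.length_cons, Function.iterate_succ_apply']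
      simp only [extend, List.mem_flatMap, List.mem_range]
      refine ⟨l.idxOf a, List.idxOf_lt_length_iff.mpr h0, l.idxOf (a + d),
        List.idxOf_lt_length_iff.mpr h1, ?_⟩
      rw [hget _ h0, hget _ h1, add_sub_cancel_left, extendAlong]
      -- The walk takes `l.length ≥ x + 1` steps; those after the first `x + 1` keep all sequences
      -- already found.
      obtain ⟨y, hy⟩ := Nat.exists_eq_add_of_le hxl
      rw [hy, add_comm (x + 1), Function.iterate_add_apply]
      exact subset_iterate_runStep _ _ _ _ hp
    · rw [List.map_append]
      refine List.Nodup.append hpn hn fun z hz hz' => ?_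
      rw [hpm'] at hz
      obtain ⟨S', hS', hz'⟩ := (hm z).mp hz'
      exact Finset.disjoint_left.mp (hdis.1 S' hS') hz hz'
    · intro z
      rw [List.map_append, List.mem_append, hpm', hm]
      simp
    · have : p.length = S.card := by
        have h := List.toFinset_card_of_nodup hpn
        rw [List.length_map] at h
        rw [← h]
        congr 1
        ext z; rw [List.mem_toFinset, hpm']
      simp [hlen, this]

/-! ### The gain criterion -/

/-- From a cover with gain at least `g` one gets disjoint sets with gain exactly `g`. -/
theorem exists_disjoint_of_cover (ss : List (Set ℤ)) : ∀ (g : ℕ) (Y : Finset ℤ),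
    (∀ z ∈ Y, ∃ s ∈ ss, z ∈ s) → g + 2 * ss.length ≤ Y.card →
    ∃ Ss : List (Finset ℤ), Ss.Pairwise Disjoint ∧
      (∀ S ∈ Ss, 2 ≤ S.card ∧ S ⊆ Y ∧ ∃ s ∈ ss, (S : Set ℤ) ⊆ s) ∧
      Ss.length ≤ g ∧ (Ss.map Finset.card).sum = g + 2 * Ss.length := by
  classical
  induction ss with
  | nil =>
    intro g Y hY hg
    have : Y = ∅ := Finset.eq_empty_of_forall_notMem fun z hz => by simpa using hY z hz
    subst this
    exact ⟨[], by simp at hg; simp [hg]⟩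
  | cons s ss ih =>
    intro g Y hY hg
    rcases Nat.eq_zero_or_pos g with rfl | hg0
    · exact ⟨[], by simp⟩
    set S := Y.filter (· ∈ s) with hSdef
    have hSY : S ⊆ Y := Finset.filter_subset _ _
    have hSs : (S : Set ℤ) ⊆ s := fun z hz => (Finset.mem_filter.mp hz).2
    have hY' : ∀ z ∈ Y \ S, ∃ s ∈ ss, z ∈ s := by
      intro z hz
      rw [Finset.mem_sdiff] at hz
      obtain ⟨s', hs', hz'⟩ := hY z hz.1
      rcases List.mem_cons.mp hs' with rfl | hs'
      · exact absurd (Finset.mem_filter.mpr ⟨hz.1, hz'⟩) hz.2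
      · exact ⟨s', hs', hz'⟩
    have hcard := Finset.card_sdiff_of_subset hSY
    have hle := Finset.card_le_card hSY
    rw [List.length_cons] at hg
    rcases le_or_gt S.card 2 with h2 | h2
    -- At most two new elements: dropping the progression removes no more elements than the bound
    -- releases, so gain `g` remains available.
    · obtain ⟨Ss, h1, h2, h3⟩ := ih g (Y \ S) hY' (by omega)
      refine ⟨Ss, h1, fun T hT => ?_, h3⟩
      obtain ⟨h4, h5, s', hs', h6⟩ := h2 T hT
      exact ⟨h4, h5.trans Finset.sdiff_subset, s', List.mem_cons_of_mem _ hs', h6⟩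
    · rcases le_or_gt (g + 2) S.card with h3 | h3
      -- This progression alone has enough gain; trimming it to `g + 2` elements makes the gain
      -- exact.
      · obtain ⟨T, hTS, hT⟩ := Finset.exists_subset_card_eq h3
        refine ⟨[T], by simp, ?_, by rwa [List.length_singleton], by simp [hT]⟩
        intro T' hT'
        rw [List.mem_singleton.mp hT']
        exact ⟨by omega, hTS.trans hSY, s, List.mem_cons_self,
          (Finset.coe_subset.mpr hTS).trans hSs⟩
      -- Here `S` contributes `S.card - 2 ≥ 1` to the gain, which pays for its place in the bound
      -- `Ss.length ≤ g`.
      · obtain ⟨Ss, h4, h5, h6, h7⟩ := ih (g - (S.card - 2)) (Y \ S) hY' (by omega)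
        refine ⟨S :: Ss, List.pairwise_cons.mpr ⟨fun T hT => ?_, h4⟩, fun T hT => ?_, ?_, ?_⟩
        · exact Finset.disjoint_of_subset_right (h5 T hT).2.1 Finset.disjoint_sdiff
        · rcases List.mem_cons.mp hT with rfl | hT
          · exact ⟨by omega, hSY, s, List.mem_cons_self, hSs⟩
          · obtain ⟨h8, h9, s', hs', h10⟩ := h5 T hT
            exact ⟨h8, h9.trans Finset.sdiff_subset, s', List.mem_cons_of_mem _ hs', h10⟩
        · simp; omega
        · simp [h7]; omega

/-- The parity term makes the gain congruent to `|X|` modulo 2. Then the number of unselected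
elements is even, they split into pairs without waste, and asking for the larger gain loses nothing
for odd `|X|`. -/
theorem coverableBelow_iff {X : Finset ℤ} {l : List ℤ} (hl : l.Nodup) (hX : l.toFinset = X)
    (k : ℕ) : CoverableBelow X k ↔ ∃ r < 2 * k + l.length % 2 + 1, ∃ q ∈ (extend l)^[r] [[]],
      q.Nodup ∧ q.length = 2 * k + l.length % 2 + 2 * r := by
  have hcard : X.card = l.length := by rw [← hX, List.toFinset_card_of_nodup hl]
  have hmemX : ∀ z, z ∈ X ↔ z ∈ l := fun z => by rw [← hX, List.mem_toFinset]
  constructor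
  · rintro ⟨m, hm, s, hs, hsX⟩
    have hm' : 2 * m + 2 * k ≤ X.card := by
      have : (2 * m + 2 * k : ℚ) ≤ X.card := by linarith
      exact_mod_cast this
    obtain ⟨Ss, h1, h2, h3, h4⟩ := exists_disjoint_of_cover (List.ofFn s)
      (2 * k + l.length % 2) X (fun z hz => by
        have : z ∈ ⋃ i, s i := hsX ▸ hz
        obtain ⟨i, hi⟩ := Set.mem_iUnion.mp this
        exact ⟨s i, List.mem_ofFn.mpr ⟨i, rfl⟩, hi⟩) (by simp; omega)
    obtain ⟨q, hq, hn, -, hlen⟩ := extend_complete (l := l) Ss h1 fun S hS => by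
      obtain ⟨h5, h6, t, ht, h7⟩ := h2 S hS
      obtain ⟨i, rfl⟩ := List.mem_ofFn.mp ht
      refine ⟨h5, s i, hs i, fun z hz => ?_, h7⟩
      have : z ∈ (X : Set ℤ) := hsX ▸ Set.mem_iUnion.mpr ⟨i, hz⟩
      exact (hmemX z).mp this
    exact ⟨Ss.length, by omega, q, hq, hn.of_map, hlen.trans h4⟩
  · rintro ⟨r, -, q, hq, hn, hlen⟩
    obtain ⟨Y, hY, hYl, hqY⟩ := extend_sound r q hq
    set W := (q.map (l.getD · 0)).toFinset with hW
    have hWY : (W : Set ℤ) ⊆ Y := by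
      intro z hz
      obtain ⟨e, he, rfl⟩ := List.mem_map.mp (List.mem_toFinset.mp hz)
      exact (hqY e he).2
    have hWX : W ⊆ X := fun z hz => (hmemX z).mpr (hYl (hWY hz))
    have hWc : W.card = q.length := by
      rw [hW, List.toFinset_card_of_nodup, List.length_map]
      refine hn.map_on fun e he e' he' h => ?_
      have h1 := (hqY e he).1
      have h2 := (hqY e' he').1
      rw [List.getD_eq_getElem _ _ h1, List.getD_eq_getElem _ _ h2] at h
      exact (hl.getElem_inj_iff).mp h
    have hle := Finset.card_le_card hWX
    have hsd := Finset.card_sdiff_of_subset hWX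
    have hu := hY.union (isUnionOfAPs_of_card_eq ((X.card - W.card) / 2) (X \ W) (by omega))
    have hXY : Y ∪ ((X \ W : Finset ℤ) : Set ℤ) = X := by
      ext z
      simp only [Set.mem_union, Finset.coe_sdiff, Set.mem_sdiff, Finset.mem_coe]
      constructor
      · rintro (h | h)
        · exact (hmemX z).mpr (hYl h)
        · exact h.1
      · intro h
        by_cases hz : z ∈ W
        · exact .inl (hWY hz)
        · exact .inr ⟨h, hz⟩
    rw [hXY] at hu
    refine ⟨_, ?_, hu⟩
    have : 2 * (r + (X.card - W.card) / 2) + 2 * k ≤ X.card := by omega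
    have : ((2 * (r + (X.card - W.card) / 2) + 2 * k : ℕ) : ℚ) ≤ X.card := by exact_mod_cast this
    push_cast at this ⊢
    linarith

/-! ### Arrays in memory and a single sweep -/

namespace RAM

/-- The configuration during the search for `s` distinct elements: the input `l`, followed by six
arrays `f 0, …, f 5` of length `2 ^ (2 * s)`. -/
structure Layout (l : List ℤ) (s : ℕ) (f : ℕ → ℕ → ℤ) (σ : State) : Prop where
  len : σ.reg 0 = l.length
  dim : σ.reg 5 = s
  half : σ.reg 6 = 2 ^ s
  size : σ.reg 7 = (2 ^ (2 * s) : ℕ)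
  base : ∀ q : ℕ, q < 6 → σ.reg (8 + q) = l.length + q * (2 ^ (2 * s) : ℕ)
  input : ∀ j : ℕ, j < l.length → σ.mem j = l.getD j 0
  arr : ∀ q m : ℕ, q < 6 → m < 2 ^ (2 * s) → σ.mem (l.length + q * (2 ^ (2 * s) : ℕ) + m) = f q m

namespace Layout

variable {l : List ℤ} {s : ℕ} {f f' : ℕ → ℕ → ℤ} {σ τ : State}

theorem frame (h : Layout l s f σ) (hf : Frame 14 σ τ) (hm : τ.mem = σ.mem) :
    Layout l s f τ where
  len := (hf 0 (by norm_num)).trans h.len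
  dim := (hf 5 (by norm_num)).trans h.dim
  half := (hf 6 (by norm_num)).trans h.half
  size := (hf 7 (by norm_num)).trans h.size
  base q hq := (hf _ (by omega)).trans (h.base q hq)
  input := hm ▸ h.input
  arr := hm ▸ h.arr

theorem update_reg (h : Layout l s f σ) {i : ℕ} (hi : 14 ≤ i) (v : ℤ) :
    Layout l s f ⟨Function.update σ.reg i v, σ.mem⟩ :=
  h.frame ((Frame.refl 14 σ).update hi _ _) rfl

theorem congr (h : Layout l s f σ) (hf : ∀ q m : ℕ, q < 6 → m < 2 ^ (2 * s) → f q m = f' q m) :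
    Layout l s f' σ :=
  { h with arr := fun q m hq hm => (h.arr q m hq hm).trans (hf q m hq hm) }

end Layout

/-- The entry of the array `q` at the index `E`. -/
def aget (q : ℕ) (E : Expr) : Expr := .mem (.add (.reg (8 + q)) E)

/-- Assignment to the entry of the array `q` at the index `E`. -/
def aset (q : ℕ) (E V : Expr) : Prog := .setMem (.add (.reg (8 + q)) E) V

variable {l : List ℤ} {s : ℕ} {f : ℕ → ℕ → ℤ} {σ : State} {Z : ℕ}

theorem Layout.eval_aget (h : Layout l s f σ) {q m : ℕ} {E : Expr} (hq : q < 6)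
    (hE : E.eval σ = m) (hm : m < 2 ^ (2 * s)) : (aget q E).eval σ = f q m := by
  simp only [aget, Expr.eval, hE, h.base q hq]
  exact h.arr q m hq hm

theorem Layout.eval_aget_reg (h : Layout l s f σ) {q m i : ℕ} (hq : q < 6)
    (hi : σ.reg i = m) (hm : m < 2 ^ (2 * s)) : (aget q (.reg i)).eval σ = f q m :=
  h.eval_aget hq hi hm

theorem Wp.aset {K e q m : ℕ} {E V : Expr} {Q : State → Prop} {v : ℤ} (h : Layout l s f σ)
    (hq : q < 6) (hE : E.eval σ = m) (hm : m < 2 ^ (2 * s)) (hV : V.eval σ = v)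
    (hK : E.cost + V.cost + 3 ≤ K)
    (hQ : ∀ μ, Layout l s (Function.update f q (Function.update (f q) m v)) ⟨σ.reg, μ⟩ →
      Q ⟨σ.reg, μ⟩) : Wp Z K e (RAM.aset q E V) σ Q := by
  refine Wp.setMem (by simp only [Expr.cost]; omega) (hQ _ ?_)
  simp only [Expr.eval, hE, hV, h.base q hq]
  refine ⟨h.len, h.dim, h.half, h.size, h.base, fun j hj => ?_, fun q' m' hq' hm' => ?_⟩
  · have : (j : ℤ) ≠ l.length + q * (2 ^ (2 * s) : ℕ) + m := by
      have : 0 ≤ (q : ℤ) * (2 ^ (2 * s) : ℕ) := by positivity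
      omega
    exact (Function.update_of_ne this _ _).trans (h.input j hj)
  · dsimp only
    by_cases hqq : q' = q
    · subst hqq
      rw [Function.update_self]
      by_cases hmm : m' = m
      · subst hmm; simp
      · rw [Function.update_of_ne hmm, Function.update_of_ne (by omega)]
        exact h.arr _ m' hq hm'
    · rw [Function.update_of_ne hqq, Function.update_of_ne, h.arr q' m' hq' hm']
      generalize 2 ^ (2 * s) = M at *
      intro he
      -- Distinct arrays do not overlap: the quotient of the offset by the array length `M` recovers
      -- the number of the array.
      have he' : q' * M + m' = q * M + m := by
        have : ((q' * M + m' : ℕ) : ℤ) = (q * M + m : ℕ) := by push_cast; linarith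
        exact_mod_cast this
      have h1 : (q' * M + m') / M = q' := by
        rw [mul_comm, Nat.mul_add_div (by omega), Nat.div_eq_of_lt hm', add_zero]
      have h2 : (q * M + m) / M = q := by
        rw [mul_comm, Nat.mul_add_div (by omega), Nat.div_eq_of_lt hm, add_zero]
      exact hqq (by rw [← h1, he', h2])

/-- Replaces every entry of the array `q` by the value of `V`, which may use the index in
register `24`. -/
def mapArr (q : ℕ) (V : Expr) : Prog := forReg 24 7 (aset q (.reg 24) V)

/-- The hypothesis on `V` reflects the moment of evaluation: entry `j` still has its old value and
the other arrays are untouched, though earlier entries of array `q` have been replaced. -/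
theorem Wp.mapArr {q : ℕ} {V : Expr} (g : ℕ → ℤ) (h : Layout l s f σ) (hq : q < 6)
    (hZ : 2 ^ (2 * s) ≤ Z + 1) (hc : V.cost ≤ 20)
    (hV : ∀ j : ℕ, j < 2 ^ (2 * s) → ∀ τ f', Layout l s f' τ → τ.reg 24 = j → f' q j = f q j →
      (∀ q', q' ≠ q → f' q' = f q') → V.eval τ = g j) :
    Wp Z 40 1 (RAM.mapArr q V) σ (fun τ => Frame 24 σ τ ∧
      Layout l s (Function.update f q g) τ) := by
  refine (Wp.forReg (K := 24) (e := 0)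
    (fun j τ => Layout l s (Function.update f q fun m => if m < j then g m else f q m) τ)
    (by norm_num) h.size hZ (by norm_num) ?_ ?_).mono le_rfl le_rfl ?_
  · simpa using h.update_reg (i := 24) (by norm_num) 0
  · intro j hj τ _ hτ hL
    refine Wp.aset hL hq hτ hj (hV j hj τ _ hL hτ (by simp) fun q' hq' => by simp [hq'])
      (by simp only [Expr.cost]; omega) fun μ hμ => ⟨fun _ _ => rfl, ?_⟩
    refine (hμ.update_reg (by norm_num) _).congr fun q' m _ _ => ?_
    by_cases hqq : q' = q
    · subst hqq
      simp only [Function.update_self]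
      by_cases hm : m = j
      · subst hm; simp
      · simp [Function.update_of_ne hm, show m < j ↔ m < j + 1 by omega]
    · simp [hqq]
  · rintro τ ⟨hF, hL⟩
    refine ⟨hF, hL.congr fun q' m _ hm => ?_⟩
    by_cases hqq : q' = q
    · subst hqq; simp [hm]
    · simp [hqq]

/-- Register `27` becomes the product of register `21` and the entry of the array `q` at the index
in register `24`. -/
def mulEntry (q : ℕ) : Prog :=
  .seq (.setReg 27 (.const 0)) (forReg 26 21 (.setReg 27 (.add (.reg 27) (aget q (.reg 24)))))

/-- The machine has no multiplication, so the entry is added `e` times. In use `e` is an index into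
`l`, so this costs one factor `Z + 1` only. -/
theorem Wp.mulEntry {q e m : ℕ} (h : Layout l s f σ) (hq : q < 6) (he : σ.reg 21 = e)
    (heZ : e ≤ Z + 1) (hm : σ.reg 24 = m) (hmM : m < 2 ^ (2 * s)) :
    Wp Z 30 1 (RAM.mulEntry q) σ (fun τ => Frame 26 σ τ ∧ Layout l s f τ ∧
      τ.reg 27 = e * f q m) := by
  refine Wp.seq (K₁ := 2) (K₂ := 28) (Wp.setReg (by simp [Expr.cost]) ?_) le_rfl
  set σ' : State := ⟨Function.update σ.reg 27 (Expr.eval σ (.const 0)), σ.mem⟩ with hσ'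
  have hF : Frame 26 σ σ' := (Frame.refl _ _).update (by norm_num) _ _
  refine (Wp.forReg (K := 14) (N := e) (e := 0)
    (fun j τ => Layout l s f τ ∧ τ.reg 27 = j * f q m)
    (by norm_num) ((hF 21 (by norm_num)).trans he) heZ (by norm_num) ?_ ?_).mono le_rfl le_rfl ?_
  · exact ⟨(h.update_reg (i := 27) (by norm_num) _).update_reg (by norm_num) _, by
      simp [hσ', Expr.eval]⟩
  · rintro j hj τ hFτ hτ ⟨hL, hacc⟩
    have h24 : τ.reg 24 = m := (hFτ 24 (by norm_num)).trans ((hF 24 (by norm_num)).trans hm)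
    refine Wp.setReg (by simp [Expr.cost, aget]) ⟨(Frame.refl _ _).update (by norm_num) _ _,
      (hL.update_reg (by norm_num) _).update_reg (by norm_num) _, ?_⟩
    have := hL.eval_aget hq (E := .reg 24) h24 hmM
    simp [Expr.eval, this, hacc]
    ring
  · rintro τ ⟨hFτ, hL, hacc⟩
    exact ⟨hF.trans hFτ, hL, hacc⟩

/-- One bit of `wedge`: register `21` holds the factor, register `23` the power of two of the
bit; array `5` holds the source with the current signs. -/
def sweepBit (q : ℕ) : Prog :=
  .seq (.setReg 25 (.const 0)) (forReg 24 7
    (.seq (mulEntry q)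
    (.seq (.ite (.sub (.add (.reg 25) (.const 1)) (.reg 23))
      (.seq (aset q (.reg 24) (.add (.reg 27) (aget 5 (.sub (.reg 24) (.reg 23)))))
        (aset 5 (.reg 24) (.sub (.const 0) (aget 5 (.reg 24)))))
      (aset q (.reg 24) (.reg 27)))
    (.seq (.setReg 25 (.add (.reg 25) (.const 1)))
      (.ite (.sub (.add (.reg 23) (.reg 23)) (.reg 25)) .skip (.setReg 25 (.const 0)))))))

/-- Lets a counter modulo `2 * 2 ^ b`, kept next to the array index, replace the missing bit
operations. -/
theorem testBit_iff_le_mod (m b : ℕ) : m.testBit b ↔ 2 ^ b ≤ m % (2 * 2 ^ b) := by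
  have hb : 0 < 2 ^ b := by positivity
  rw [Nat.testBit_eq_decide_div_mod_eq, decide_eq_true_iff, mul_comm 2, Nat.mod_mul]
  have h1 := Nat.mod_lt m hb
  rcases Nat.mod_two_eq_zero_or_one (m / 2 ^ b) with h | h
  · simp [h]; exact h1
  · simp [h]

theorem succ_mod_eq {j P : ℕ} (hP : 0 < P) :
    (j + 1) % P = if j % P + 1 < P then j % P + 1 else 0 := by
  have := Nat.mod_lt j hP
  rw [Nat.add_mod]
  split_ifs with h
  · have h1 : 1 < P := by omega
    rw [Nat.mod_eq_of_lt h1, Nat.mod_eq_of_lt h]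
  · rcases Nat.lt_or_ge 1 P with h1 | h1
    · rw [Nat.mod_eq_of_lt h1, show j % P + 1 = P by omega, Nat.mod_self]
    · have : P = 1 := by omega
      subst this; simp [Nat.mod_one]

theorem Wp.sweepBit {q e b : ℕ} (h : Layout l s f σ) (hq : q < 5) (he : σ.reg 21 = e)
    (heZ : e ≤ Z + 1) (hZ : 2 ^ (2 * s) ≤ Z + 1) (hb : σ.reg 23 = 2 ^ b) :
    Wp Z 120 2 (RAM.sweepBit q) σ (fun τ => Frame 24 σ τ ∧ ∃ f', Layout l s f' τ ∧
      (∀ q', q' ≠ q → q' ≠ 5 → f' q' = f q') ∧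
      (∀ m < 2 ^ (2 * s), f' q m = e * f q m + if m.testBit b then f 5 (m - 2 ^ b) else 0) ∧
      (∀ m < 2 ^ (2 * s), f' 5 m = if m.testBit b then -f 5 m else f 5 m)) := by
  have hq5 : (5 : ℕ) ≠ q := by omega
  refine Wp.seq (K₁ := 2) (K₂ := 118) (Wp.setReg (by simp [Expr.cost]) ?_) le_rfl
  set σ' : State := ⟨Function.update σ.reg 25 (Expr.eval σ (.const 0)), σ.mem⟩ with hσ'
  have hF : Frame 24 σ σ' := (Frame.refl _ _).update (by norm_num) _ _
  have hL' : Layout l s f σ' := h.update_reg (by norm_num) _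
  set Dn : ℕ → ℤ := fun m => e * f q m + if m.testBit b then f 5 (m - 2 ^ b) else 0 with hDn
  set Tn : ℕ → ℤ := fun m => if m.testBit b then -f 5 m else f 5 m with hTn
  refine (Wp.forReg (K := 100) (e := 1)
    (fun j τ => τ.reg 25 = ((j % (2 * 2 ^ b) : ℕ) : ℤ) ∧ ∃ f', Layout l s f' τ ∧
      (∀ q', q' ≠ q → q' ≠ 5 → f' q' = f q') ∧
      (∀ m, f' q m = if m < j then Dn m else f q m) ∧
      (∀ m, f' 5 m = if m < j then Tn m else f 5 m))
    (by norm_num) hL'.size hZ (by norm_num) ?_ ?_).mono le_rfl le_rfl ?_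
  · exact ⟨by simp [hσ', Expr.eval], f, hL'.update_reg (by norm_num) _, fun _ _ _ => rfl,
      by simp, by simp⟩
  · rintro j hj τ hFτ hτ ⟨hc, f', hL, hoth, hD, hT⟩
    have h21 : τ.reg 21 = e := (hFτ 21 (by norm_num)).trans ((hF 21 (by norm_num)).trans he)
    have h23 : τ.reg 23 = 2 ^ b := (hFτ 23 (by norm_num)).trans ((hF 23 (by norm_num)).trans hb)
    refine Wp.seq (K₁ := 30) (K₂ := 70)
      ((Wp.mulEntry hL (by omega) h21 heZ hτ hj).mono le_rfl le_rfl ?_) le_rfl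
    rintro τ₁ ⟨hF₁, hL₁, h27⟩
    have h23₁ : τ₁.reg 23 = 2 ^ b := (hF₁ 23 (by norm_num)).trans h23
    have h24₁ : τ₁.reg 24 = j := (hF₁ 24 (by norm_num)).trans hτ
    have h25₁ := (hF₁ 25 (by norm_num)).trans hc
    rw [hD, if_neg (lt_irrefl j)] at h27
    refine Wp.seq (K₁ := 50) (K₂ := 20) (K := 70) (Wp.mono (e := 1) (K := 50)
      (Q := fun ρ => Frame 26 τ₁ ρ ∧ ∃ f'', Layout l s f'' ρ ∧
        (∀ q', q' ≠ q → q' ≠ 5 → f'' q' = f q') ∧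
        (∀ m, f'' q m = if m < j + 1 then Dn m else f q m) ∧
        (∀ m, f'' 5 m = if m < j + 1 then Tn m else f 5 m)) ?_ le_rfl le_rfl ?_) le_rfl
    · have hlt : ∀ m, m ≠ j → (m < j + 1 ↔ m < j) := fun m hm => by omega
      refine Wp.ite (K := 40) (by simp [Expr.cost]) (fun hpos => ?_) (fun hneg => ?_)
      · have hbit : j.testBit b := by
          rw [testBit_iff_le_mod]
          simp only [Expr.eval, h25₁, h23₁] at hpos
          have : (2 ^ b : ℤ) ≤ ((j % (2 * 2 ^ b) : ℕ) : ℤ) := by linarith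
          exact_mod_cast this
        have hle : 2 ^ b ≤ j := Nat.ge_two_pow_of_testBit hbit
        have hpb : 0 < 2 ^ b := by positivity
        have hidx : (Expr.sub (.reg 24) (.reg 23)).eval τ₁ = ((j - 2 ^ b : ℕ) : ℤ) := by
          simp only [Expr.eval, h24₁, h23₁]
          push_cast [hle]; rfl
        have hval : (Expr.add (.reg 27) (aget 5 (.sub (.reg 24) (.reg 23)))).eval τ₁ = Dn j := by
          -- The index `j - 2 ^ b` has already been passed, but its bit `b` is clear, so its sign
          -- was not flipped; this makes the update in place safe.
          have h5 : f' 5 (j - 2 ^ b) = f 5 (j - 2 ^ b) := by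
            rw [hT, if_pos (by omega)]
            simp [hTn, testBit_sub_two_pow hbit]
          rw [Expr.eval, hL₁.eval_aget (by norm_num) hidx (by omega), h5]
          simp [Expr.eval, h27, hDn, hbit]
        refine Wp.seq (K₁ := 20) (K₂ := 20) (Wp.aset hL₁ (by omega) h24₁ hj hval
          (by simp [Expr.cost, aget]) fun μ hμ => ?_) le_rfl
        have hv2 : (Expr.sub (.const 0) (aget 5 (.reg 24))).eval ⟨τ₁.reg, μ⟩ = Tn j := by
          rw [Expr.eval, hμ.eval_aget_reg (by norm_num) h24₁ hj]
          simp [hq5, Expr.eval, hT, hTn, hbit]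
        refine Wp.aset hμ (by norm_num) h24₁ hj hv2 (by simp [Expr.cost, aget])
          fun μ' hμ' => ⟨fun _ _ => rfl, _, hμ', ?_, ?_, ?_⟩
        · intro q' h1 h2; simp [h1, h2, hoth]
        · intro m
          simp only [Function.update_of_ne hq5.symm, Function.update_self]
          by_cases hm : m = j
          · subst hm; simp
          · simp [hm, hD, hlt m hm]
        · intro m
          simp only [Function.update_of_ne hq5, Function.update_self]
          by_cases hm : m = j
          · subst hm; simp
          · simp [hm, hT, hlt m hm]
      · have hbit : ¬ j.testBit b := by
          rw [testBit_iff_le_mod]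
          simp only [Expr.eval, h25₁, h23₁] at hneg
          have : ((j % (2 * 2 ^ b) : ℕ) : ℤ) < ((2 ^ b : ℕ) : ℤ) := by push_cast at hneg ⊢; linarith
          have := Int.ofNat_lt.mp this
          omega
        refine Wp.aset hL₁ (by omega) h24₁ hj (v := Dn j) (by simp [Expr.eval, h27, hDn, hbit])
          (by simp [Expr.cost]) fun μ hμ => ⟨fun _ _ => rfl, _, hμ, ?_, ?_, ?_⟩
        · intro q' h1 h2; simp [h1, h2, hoth]
        · intro m
          simp only [Function.update_self]
          by_cases hm : m = j
          · subst hm; simp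
          · simp [hm, hD, hlt m hm]
        · intro m
          simp only [Function.update_of_ne hq5]
          by_cases hm : m = j
          · subst hm; simp [hT, hTn, hbit]
          · simp [hT, hlt m hm]
    · rintro τ₂ ⟨hF₂, f'', hL₂, ho₂, hD₂, hT₂⟩
      have h23₂ : τ₂.reg 23 = 2 ^ b := (hF₂ 23 (by norm_num)).trans h23₁
      have h25₂ := (hF₂ 25 (by norm_num)).trans h25₁
      have hF24 : Frame 25 τ τ₂ := (hF₁.trans hF₂).mono (by norm_num)
      refine Wp.seq (K₁ := 5) (K₂ := 15) (Wp.setReg (by simp [Expr.cost]) ?_) le_rfl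
      have hmod := succ_mod_eq (j := j) (P := 2 * 2 ^ b) (by positivity)
      have hev : (Expr.sub (.add (.reg 23) (.reg 23)) (.reg 25)).eval
          ⟨Function.update τ₂.reg 25 (Expr.eval τ₂ (.add (.reg 25) (.const 1))), τ₂.mem⟩ =
          ((2 * 2 ^ b : ℕ) : ℤ) - ((j % (2 * 2 ^ b) : ℕ) + 1) := by
        simp [Expr.eval, h23₂, h25₂]
        ring
      refine Wp.ite (K := 5) (by simp [Expr.cost]) (fun hpos => ?_) (fun hneg => ?_)
      · rw [hev] at hpos
        refine Wp.skip (by norm_num) ⟨hF24.update le_rfl _ _, ?_, f'',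
          (hL₂.update_reg (by norm_num) _).update_reg (by norm_num) _, ho₂, hD₂, hT₂⟩
        rw [hmod, if_pos (by omega)]
        simp [Expr.eval, h25₂]
      · rw [hev] at hneg
        refine Wp.setReg (by simp [Expr.cost]) ⟨(hF24.update le_rfl _ _).update le_rfl _ _, ?_,
          f'', ((hL₂.update_reg (i := 25) (by norm_num) _).update_reg (by norm_num) _).update_reg
            (by norm_num) _, ho₂, hD₂, hT₂⟩
        rw [hmod, if_neg (by omega)]
        simp [Expr.eval]
  · rintro τ ⟨hFτ, -, f', hL, h1, h2, h3⟩
    exact ⟨hF.trans hFτ, f', hL, h1, fun m hm => by rw [h2, if_pos hm],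
      fun m hm => by rw [h3, if_pos hm]⟩

end RAM

/-! ### Exterior products and extensions as programs -/

namespace RAM

variable {l : List ℤ} {s : ℕ} {f : ℕ → ℕ → ℤ} {σ : State} {Z : ℕ}

/-- The array `q` becomes `wedge` of the array `p`, for the bits from that of `start` on. -/
def wedgeArr (p q : ℕ) (start : Expr) : Prog :=
  .seq (mapArr q (.const 0)) (.seq (mapArr 5 (aget p (.reg 24))) (.seq (.setReg 23 start)
    (forReg 22 5 (.seq (sweepBit q) (.setReg 23 (.add (.reg 23) (.reg 23)))))))

/-- After `a` bits array `q` holds the partial Horner sum and array `5` the source with sign `(-1)`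
to the number of set bits among these `a`, which is the sign needed at the next bit. -/
theorem Wp.wedgeArr {p q e o : ℕ} {start : Expr} (h : Layout l s f σ) (hq : q < 5) (hp : p < 5)
    (hpq : p ≠ q) (he : σ.reg 21 = e) (heZ : e ≤ Z + 1) (hZ : 2 ^ (2 * s) ≤ Z + 1)
    (ho : ∀ τ, Frame 22 σ τ → start.eval τ = 2 ^ o) (hc : start.cost ≤ 10) :
    Wp Z 300 3 (RAM.wedgeArr p q start) σ (fun τ => Frame 22 σ τ ∧ ∃ f', Layout l s f' τ ∧
      (∀ q', q' ≠ q → q' ≠ 5 → f' q' = f q') ∧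
      (∀ m < 2 ^ (2 * s), f' q m = wedge o e (f p) s m)) := by
  refine Wp.seq (K₁ := 40) (K₂ := 260) ((Wp.mapArr (fun _ => 0) h (by omega) hZ
    (by simp [Expr.cost]) (by intros; rfl)).mono le_rfl (by norm_num) ?_) le_rfl
  rintro τ₁ ⟨hF₁, hL₁⟩
  refine Wp.seq (K₁ := 40) (K₂ := 220) ((Wp.mapArr (f p) hL₁ (by norm_num) hZ
    (by simp [Expr.cost, aget]) ?_).mono le_rfl (by norm_num) ?_) le_rfl
  · intro j hj τ f' hL hτ _ hf'
    rw [hL.eval_aget_reg (by omega) hτ hj, hf' p (by omega), Function.update_of_ne hpq]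
  rintro τ₂ ⟨hF₂, hL₂⟩
  have hF : Frame 22 σ τ₂ := (hF₁.trans hF₂).mono (by norm_num)
  refine Wp.seq (K₁ := 20) (K₂ := 200) (Wp.setReg (by omega) ?_) le_rfl
  rw [ho τ₂ hF]
  set τ₃ : State := ⟨Function.update τ₂.reg 23 (2 ^ o), τ₂.mem⟩ with hτ₃
  have hF₃ : Frame 22 σ τ₃ := hF.update (by norm_num) _ _
  have hL₃ : Layout l s _ τ₃ := hL₂.update_reg (by norm_num) _
  have hq5 : (5 : ℕ) ≠ q := by omega
  have hlt : s ≤ 2 ^ (2 * s) := by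
    have := (Nat.lt_two_pow_self (n := 2 * s)).le
    omega
  refine (Wp.forReg (K := 140) (K' := 200) (e := 2) (fun a τ => τ.reg 23 = 2 ^ (o + a) ∧ ∃ f',
      Layout l s f' τ ∧ (∀ q', q' ≠ q → q' ≠ 5 → f' q' = f q') ∧
      (∀ m < 2 ^ (2 * s), f' q m = wedge o e (f p) a m) ∧
      (∀ m < 2 ^ (2 * s), f' 5 m = (-1) ^ (bitSet a o m).card * f p m))
    (by norm_num) hL₃.dim (by omega) (by norm_num) ?_ ?_).mono (by norm_num) le_rfl ?_
  · refine ⟨by simp [hτ₃], _, hL₃.update_reg (by norm_num) _, ?_, ?_, ?_⟩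
    · intro q' h1 h2; simp [h1, h2]
    · intro m _; simp [hq5.symm, wedge]
    · intro m _; simp [bitSet]
  · rintro a ha τ hFτ hτ ⟨h23, f', hL, ho', hD, hT⟩
    have h21 : τ.reg 21 = e := (hFτ 21 (by norm_num)).trans ((hF₃ 21 (by norm_num)).trans he)
    refine Wp.seq (K₁ := 120) (K₂ := 20)
      ((Wp.sweepBit hL hq h21 heZ hZ h23).mono le_rfl le_rfl ?_) le_rfl
    rintro ρ ⟨hFρ, f'', hL', ho'', hD', hT'⟩
    refine Wp.setReg (by simp [Expr.cost]) ⟨(hFρ.mono (by norm_num)).update (by norm_num) _ _,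
      ?_, f'', (hL'.update_reg (by norm_num) _).update_reg (by norm_num) _, ?_, ?_, ?_⟩
    · have := (hFρ 23 (by norm_num)).trans h23
      simp [Expr.eval, this]; ring
    · intro q' h1 h2; rw [ho'' q' h1 h2, ho' q' h1 h2]
    · intro m hm
      rw [hD' m hm, wedge, hD m hm]
      split_ifs with hb
      · rw [hT _ ((Nat.sub_le _ _).trans_lt hm)]
        have : bitSet a o (m - 2 ^ (o + a)) = bitSet a o m :=
          bitSet_sub_of_disjoint hb (by intros; omega)
        rw [this]
      · rfl
    · intro m hm
      rw [hT' m hm, hT m hm]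
      have : bitSet (a + 1) o m =
          if m.testBit (o + a) then insert a (bitSet a o m) else bitSet a o m := by
        simp [bitSet, Finset.range_add_one, Finset.filter_insert]
      rw [this]
      split_ifs with hb
      · rw [Finset.card_insert_of_notMem (by simp [bitSet])]; ring
      · rfl
  · rintro τ ⟨hFτ, -, f', hL, h1, h2, -⟩
    exact ⟨hF₃.trans hFτ, f', hL, h1, h2⟩

/-- The array `q` represents the formal sum `L`. -/
def Represents (s : ℕ) (f : ℕ → ℕ → ℤ) (q : ℕ) (L : List (List ℕ)) : Prop :=
  ∀ m < 2 ^ (2 * s), f q m = value s L m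

/-- Adds to the formal sum in array `2` its lists extended by the index in register `21`. -/
def addIndex : Prog :=
  .seq (wedgeArr 2 3 (.const 1)) (.seq (wedgeArr 3 4 (.reg 6))
    (mapArr 2 (.add (aget 2 (.reg 24)) (aget 4 (.reg 24)))))

theorem Wp.addIndex {e : ℕ} {L : List (List ℕ)} (h : Layout l s f σ) (hL : Represents s f 2 L)
    (he : σ.reg 21 = e) (heZ : e ≤ Z + 1) (hZ : 2 ^ (2 * s) ≤ Z + 1) :
    Wp Z 640 3 RAM.addIndex σ (fun τ => Frame 22 σ τ ∧ ∃ f', Layout l s f' τ ∧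
      f' 0 = f 0 ∧ f' 1 = f 1 ∧ Represents s f' 2 (L ++ L.map (e :: ·))) := by
  refine Wp.seq (K₁ := 300) (K₂ := 340) ((Wp.wedgeArr (o := 0) h (by norm_num) (by norm_num)
    (by norm_num) he heZ hZ (fun _ _ => by simp [Expr.eval]) (by simp [Expr.cost])).mono
      le_rfl le_rfl ?_) le_rfl
  rintro τ₁ ⟨hF₁, f₁, hL₁, ho₁, hw₁⟩
  refine Wp.seq (K₁ := 300) (K₂ := 40) ((Wp.wedgeArr (o := s) (start := .reg 6) hL₁ (by norm_num) (by norm_num)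
    (by norm_num) ((hF₁ 21 (by norm_num)).trans he) heZ hZ
    (fun τ hτ => (hτ 6 (by norm_num)).trans hL₁.half) (by simp [Expr.cost])).mono
      le_rfl le_rfl ?_) le_rfl
  rintro τ₂ ⟨hF₂, f₂, hL₂, ho₂, hw₂⟩
  refine (Wp.mapArr (fun m => f₂ 2 m + f₂ 4 m) hL₂ (by norm_num) hZ
    (by simp [Expr.cost, aget]) ?_).mono le_rfl (by norm_num) ?_
  · intro j hj τ f' hL' hτ h2 hf'
    rw [Expr.eval, hL'.eval_aget_reg (by norm_num) hτ hj,
      hL'.eval_aget_reg (by norm_num) hτ hj, h2, hf' 4 (by norm_num)]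
  · rintro τ₃ ⟨hF₃, hL₃⟩
    refine ⟨(hF₁.trans hF₂).trans (hF₃.mono (by norm_num)), _, hL₃, ?_, ?_, ?_⟩
    · simp [ho₂, ho₁]
    · simp [ho₂, ho₁]
    · intro m hm
      rw [Function.update_self, hw₂ m hm, ho₂ 2 (by norm_num) (by norm_num),
        ho₁ 2 (by norm_num) (by norm_num), value_append, ← wedge_wedge_value, hL m hm]
      congr 1
      refine wedge_congr fun m' hm' => ?_
      rw [hw₁ m' (by omega)]
      exact wedge_congr fun m'' hm'' => hL m'' (by omega)

/-- Register `21` becomes the position of the number in register `19`. -/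
def findIndex : Prog :=
  .seq (.setReg 21 (.reg 0)) (forReg 20 0
    (.ite (.sub (.reg 19) (.mem (.reg 20))) .skip
      (.ite (.sub (.mem (.reg 20)) (.reg 19)) .skip (.setReg 21 (.reg 20)))))

/-- The scan does not stop at a match, so it records the last one; without repetitions this is
`idxOf`. The initial value `l.length` remains if there is no match, as in `idxOf`. -/
theorem Wp.findIndex (hl : l.Nodup) (h : Layout l s f σ) (hn : l.length ≤ Z + 1) :
    Wp Z 50 1 RAM.findIndex σ (fun τ => Frame 20 σ τ ∧ Layout l s f τ ∧
      τ.reg 21 = l.idxOf (σ.reg 19)) := by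
  refine Wp.seq (K₁ := 2) (K₂ := 48) (Wp.setReg (by simp [Expr.cost]) ?_) le_rfl
  set σ' : State := ⟨Function.update σ.reg 21 (Expr.eval σ (.reg 0)), σ.mem⟩ with hσ'
  have hF : Frame 20 σ σ' := (Frame.refl _ _).update (by norm_num) _ _
  have hL' : Layout l s f σ' := h.update_reg (by norm_num) _
  set x := σ.reg 19 with hx
  refine (Wp.forReg (K := 30) (K' := 48) (e := 0) (fun j τ => Layout l s f τ ∧
      τ.reg 21 = if l.idxOf x < j then (l.idxOf x : ℤ) else l.length)
    (by norm_num) hL'.len hn (by norm_num) ?_ ?_).mono (by norm_num) le_rfl ?_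
  · refine ⟨hL'.update_reg (by norm_num) _, ?_⟩
    simp [hσ', Expr.eval, h.len]
  · rintro j hj τ hFτ hτ ⟨hL, h21⟩
    have h19 : τ.reg 19 = x := (hFτ 19 (by norm_num)).trans (hF 19 (by norm_num))
    have hmem : τ.mem j = l[j] := by rw [hL.input j hj, List.getD_eq_getElem _ _ hj]
    have hne : l[j] ≠ x → l.idxOf x ≠ j := by
      rintro h1 rfl
      exact h1 (List.getElem_idxOf hj)
    have hskip : l[j] ≠ x → Frame 21 τ τ ∧
        Layout l s f ⟨Function.update τ.reg 20 ((j : ℤ) + 1), τ.mem⟩ ∧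
        (Function.update τ.reg 20 ((j : ℤ) + 1)) 21 =
          if l.idxOf x < j + 1 then (l.idxOf x : ℤ) else l.length := by
      intro hneq
      refine ⟨Frame.refl _ _, hL.update_reg (by norm_num) _, ?_⟩
      have := hne hneq
      rw [Function.update_of_ne (by norm_num), h21]
      simp only [show l.idxOf x < j + 1 ↔ l.idxOf x < j by omega]
    refine Wp.ite (K := 20) (by simp [Expr.cost]) (fun hpos => ?_) fun hneg => ?_
    · simp only [Expr.eval, h19, hτ, hmem] at hpos
      exact Wp.skip (by norm_num) (hskip (by omega))
    refine Wp.ite (K := 10) (by simp [Expr.cost]) (fun hpos' => ?_) fun hneg' => ?_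
    · simp only [Expr.eval, h19, hτ, hmem] at hpos'
      exact Wp.skip (by norm_num) (hskip (by omega))
    · simp only [Expr.eval, h19, hτ, hmem] at hneg hneg'
      have hxj : l[j] = x := by omega
      have hidx : l.idxOf x = j := by rw [← hxj]; exact hl.idxOf_getElem j hj
      refine Wp.setReg (by simp [Expr.cost]) ⟨(Frame.refl _ _).update (by norm_num) _ _,
        (hL.update_reg (by norm_num) _).update_reg (by norm_num) _, ?_⟩
      simp [Expr.eval, hτ, hidx]
  · rintro τ ⟨hFτ, hL, h21⟩
    refine ⟨hF.trans hFτ, hL, ?_⟩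
    rw [h21]
    split_ifs with h1
    · rfl
    · have := List.idxOf_le_length (a := x) (l := l)
      have : l.idxOf x = l.length := by omega
      rw [this]

/-- Extends the formal sum in array `0` along the progression given by the elements with the
indices in registers `15` and `16`, and adds the result to array `1`. -/
def extendAlongProg : Prog :=
  .seq (mapArr 2 (aget 0 (.reg 24)))
  (.seq (.setReg 19 (.mem (.reg 15)))
  (.seq (.setReg 17 (.sub (.mem (.reg 16)) (.mem (.reg 15))))
  (.seq (forReg 18 0 (.seq findIndex (.ite (.sub (.reg 0) (.reg 21))
    (.seq addIndex (.setReg 19 (.add (.reg 19) (.reg 17)))) .skip)))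
  (mapArr 1 (.add (aget 1 (.reg 24)) (aget 2 (.reg 24)))))))

theorem Wp.extendAlongProg {L L₁ : List (List ℕ)} {i j : ℕ} (hl : l.Nodup) (h : Layout l s f σ)
    (hn : l.length ≤ Z + 1) (hZ : 2 ^ (2 * s) ≤ Z + 1) (hi : i < l.length) (hj : j < l.length)
    (hri : σ.reg 15 = i) (hrj : σ.reg 16 = j)
    (hL : Represents s f 0 L) (hL₁ : Represents s f 1 L₁) :
    Wp Z 1000 4 RAM.extendAlongProg σ (fun τ => Frame 17 σ τ ∧ ∃ f', Layout l s f' τ ∧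
      Represents s f' 0 L ∧ Represents s f' 1
        (L₁ ++ extendAlong l (l.getD j 0 - l.getD i 0) (l.getD i 0) L)) := by
  refine Wp.seq (K₁ := 40) (K₂ := 960) ((Wp.mapArr (f 0) h (by norm_num) hZ
    (by simp [Expr.cost, aget]) ?_).mono le_rfl (by norm_num) ?_) le_rfl
  · intro m hm τ f' hL' hτ _ hf'
    rw [hL'.eval_aget_reg (by norm_num) hτ hm, hf' 0 (by norm_num)]
  rintro τ₁ ⟨hF₁, hy₁⟩
  have h15 : τ₁.reg 15 = i := (hF₁ 15 (by norm_num)).trans hri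
  have h16 : τ₁.reg 16 = j := (hF₁ 16 (by norm_num)).trans hrj
  set a := l.getD i 0 with ha
  set d := l.getD j 0 - a with hd
  refine Wp.seq (K₁ := 20) (K₂ := 940) (Wp.setReg (by simp [Expr.cost]) ?_) le_rfl
  have e1 : Expr.eval τ₁ (.mem (.reg 15)) = a := by
    simp only [Expr.eval, h15]; exact hy₁.input i hi
  rw [e1]
  refine Wp.seq (K₁ := 20) (K₂ := 920) (Wp.setReg (by simp [Expr.cost]) ?_) le_rfl
  have e2 : Expr.eval ⟨Function.update τ₁.reg 19 a, τ₁.mem⟩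
      (.sub (.mem (.reg 16)) (.mem (.reg 15))) = d := by
    simp [Expr.eval, h15, h16, hy₁.input i hi, hy₁.input j hj, hd, ha]
  rw [e2]
  set τ₂ : State := ⟨Function.update (Function.update τ₁.reg 19 a) 17 d, τ₁.mem⟩ with hτ₂
  have hF₂ : Frame 17 σ τ₂ := fun i hi => by
    rw [← hF₁ i (by omega), hτ₂]
    simp [show i ≠ 17 by omega, show i ≠ 19 by omega]
  have hy₂ : Layout l s _ τ₂ :=
    (hy₁.update_reg (i := 19) (by norm_num) a).update_reg (by norm_num) _
  refine Wp.seq (K₁ := 800) (K₂ := 120) ((Wp.forReg (K := 760) (e := 3) (fun t τ =>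
      τ.reg 19 = ((runStep l d)^[t] (a, L)).1 ∧ ∃ f', Layout l s f' τ ∧ f' 0 = f 0 ∧
        f' 1 = f 1 ∧ Represents s f' 2 ((runStep l d)^[t] (a, L)).2)
    (by norm_num) hy₂.len hn (by norm_num) ?_ ?_).mono le_rfl le_rfl ?_) le_rfl
  · refine ⟨by simp [hτ₂], _, hy₂.update_reg (by norm_num) _, by simp, by simp, ?_⟩
    intro m hm
    simpa using hL m hm
  · rintro t ht τ hFτ hτ ⟨h19, f', hy, hf0, hf1, hf2⟩
    rw [Function.iterate_succ_apply']
    set P := (runStep l d)^[t] (a, L)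
    refine Wp.seq (K₁ := 50) (K₂ := 700)
      ((Wp.findIndex hl hy hn).mono le_rfl (by norm_num) ?_) (by norm_num)
    rintro ρ ⟨hFρ, hyρ, h21⟩
    rw [h19] at h21
    have hr : (Expr.sub (.reg 0) (.reg 21)).eval ρ = l.length - l.idxOf P.1 := by
      simp [Expr.eval, hyρ.len, h21]
    refine Wp.ite (K := 680) (by simp [Expr.cost]) (fun hpos => ?_) fun hneg => ?_
    · rw [hr] at hpos
      have hlt : l.idxOf P.1 < l.length := by omega
      refine Wp.seq (K₁ := 640) (K₂ := 20) ((Wp.addIndex hyρ hf2 h21 (by omega) hZ).mono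
        le_rfl le_rfl ?_) (by norm_num)
      rintro ρ' ⟨hFρ', f'', hyρ', hf0', hf1', hf2'⟩
      have h19' : ρ'.reg 19 = P.1 :=
        (hFρ' 19 (by norm_num)).trans ((hFρ 19 (by norm_num)).trans h19)
      have h17 : ρ'.reg 17 = d := by
        rw [hFρ' 17 (by norm_num), hFρ 17 (by norm_num), hFτ 17 (by norm_num), hτ₂]; simp
      refine Wp.setReg (by simp [Expr.cost])
        ⟨((hFρ.mono (by norm_num)).trans (hFρ'.mono (by norm_num))).update le_rfl _ _, ?_, f'',
          (hyρ'.update_reg (by norm_num) _).update_reg (by norm_num) _, hf0'.trans hf0,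
          hf1'.trans hf1, ?_⟩
      · simp [Expr.eval, h19', h17, runStep, hlt]
      · simpa [runStep, hlt] using hf2'
    · rw [hr] at hneg
      have hlt : ¬ l.idxOf P.1 < l.length := by omega
      refine Wp.skip (by norm_num) ⟨hFρ.mono (by norm_num), ?_, f',
        hyρ.update_reg (by norm_num) _, hf0, hf1, ?_⟩
      · simp [runStep, hlt, (hFρ 19 (by norm_num)).trans h19]
      · simpa [runStep, hlt] using hf2
  · rintro τ₃ ⟨hF₃, -, f', hy₃, hf0, hf1, hf2⟩
    refine (Wp.mapArr (fun m => f' 1 m + f' 2 m) hy₃ (by norm_num) hZ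
      (by simp [Expr.cost, aget]) ?_).mono (by norm_num) (by norm_num) ?_
    · intro m hm τ f'' hy hτ h1 hf''
      rw [Expr.eval, hy.eval_aget_reg (by norm_num) hτ hm,
        hy.eval_aget_reg (by norm_num) hτ hm, h1, hf'' 2 (by norm_num)]
    · rintro τ₄ ⟨hF₄, hy₄⟩
      refine ⟨(hF₂.trans (hF₃.mono (by norm_num))).trans (hF₄.mono (by norm_num)), _, hy₄, ?_, ?_⟩
      · intro m hm; simpa [hf0] using hL m hm
      · intro m hm
        rw [Function.update_self, value_append, hf2 m hm, hf1, hL₁ m hm]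
        rfl

/-- Extends the formal sum in array `0` along all progressions. -/
def extendProg : Prog :=
  .seq (mapArr 1 (.const 0)) (.seq (forReg 15 0 (forReg 16 0 extendAlongProg))
    (mapArr 0 (aget 1 (.reg 24))))

theorem Wp.extendProg {L : List (List ℕ)} (hl : l.Nodup) (h : Layout l s f σ)
    (hn : l.length ≤ Z + 1) (hZ : 2 ^ (2 * s) ≤ Z + 1) (hL : Represents s f 0 L) :
    Wp Z 1200 6 RAM.extendProg σ (fun τ => Frame 15 σ τ ∧ ∃ f', Layout l s f' τ ∧
      Represents s f' 0 (extend l L)) := by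
  refine Wp.seq (K₁ := 40) (K₂ := 1160) ((Wp.mapArr (fun _ => 0) h (by norm_num) hZ
    (by simp [Expr.cost]) (by intros; rfl)).mono le_rfl (by norm_num) ?_) le_rfl
  rintro τ₁ ⟨hF₁, hy₁⟩
  let row : ℕ → ℕ → List (List ℕ) := fun i j => (List.range j).flatMap fun j =>
    extendAlong l (l.getD j 0 - l.getD i 0) (l.getD i 0) L
  let rows : ℕ → List (List ℕ) := fun i => (List.range i).flatMap fun i => row i l.length
  refine Wp.seq (K₁ := 1100) (K₂ := 60) ((Wp.forReg (K := 1080) (e := 5) (fun i τ => ∃ f',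
      Layout l s f' τ ∧ Represents s f' 0 L ∧ Represents s f' 1 (rows i))
    (by norm_num) hy₁.len hn (by norm_num) ?_ ?_).mono le_rfl le_rfl ?_) le_rfl
  · refine ⟨_, hy₁.update_reg (by norm_num) _, fun m hm => ?_, fun m hm => ?_⟩
    · simpa using hL m hm
    · simp [rows, value]
  · rintro i hi τ hFτ hτ ⟨f', hy, hf0, hf1⟩
    refine (Wp.forReg (K := 1000) (e := 4) (fun j τ => ∃ f',
        Layout l s f' τ ∧ Represents s f' 0 L ∧ Represents s f' 1 (rows i ++ row i j))
      (by norm_num) hy.len hn (by norm_num) ?_ ?_).mono le_rfl le_rfl ?_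
    · exact ⟨f', hy.update_reg (by norm_num) _, hf0, by simpa [row] using hf1⟩
    · rintro j hj ρ hFρ hρ ⟨f'', hy', hf0', hf1'⟩
      refine (Wp.extendAlongProg hl hy' hn hZ hi hj ((hFρ 15 (by norm_num)).trans hτ) hρ hf0'
        hf1').mono le_rfl le_rfl ?_
      rintro ρ' ⟨hFρ', g, hyg, hg0, hg1⟩
      refine ⟨hFρ', g, hyg.update_reg (by norm_num) _, hg0, ?_⟩
      have : rows i ++ row i (j + 1) = rows i ++ row i j ++
          extendAlong l (l.getD j 0 - l.getD i 0) (l.getD i 0) L := by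
        simp [row, List.range_succ, List.flatMap_append]
      rwa [this]
    · rintro ρ ⟨hFρ, f'', hy', hf0', hf1'⟩
      refine ⟨hFρ, f'', hy'.update_reg (by norm_num) _, hf0', ?_⟩
      have : rows (i + 1) = rows i ++ row i l.length := by
        simp [rows, List.range_succ, List.flatMap_append]
      rwa [this]
  · rintro τ₂ ⟨hF₂, f', hy₂, -, hf1⟩
    refine (Wp.mapArr (f' 1) hy₂ (by norm_num) hZ (by simp [Expr.cost, aget]) ?_).mono
      (by norm_num) (by norm_num) ?_
    · intro m hm τ f'' hy hτ _ hf''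
      rw [hy.eval_aget_reg (by norm_num) hτ hm, hf'' 1 (by norm_num)]
    · rintro τ₃ ⟨hF₃, hy₃⟩
      refine ⟨((hF₁.mono (by norm_num)).trans hF₂).trans (hF₃.mono (by norm_num)), _, hy₃, ?_⟩
      intro m hm
      rw [Function.update_self]
      exact hf1 m hm

end RAM

/-! ### The search and the decision procedure -/

namespace RAM

variable {l : List ℤ} {s : ℕ} {f : ℕ → ℕ → ℤ} {σ : State} {Z : ℕ}

/-- Applies `V` as many times as register `5` says to register `15`, starting from `1`. -/
def powProg (V : Expr) : Prog := .seq (.setReg 15 (.const 1)) (forReg 14 5 (.setReg 15 V))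

theorem Wp.powProg {V : Expr} {b : ℤ} (hs : σ.reg 5 = s) (hsZ : s ≤ Z + 1) (hc : V.cost ≤ 10)
    (hV : ∀ τ, V.eval τ = b * τ.reg 15) :
    Wp Z 30 1 (RAM.powProg V) σ (fun τ => Frame 14 σ τ ∧ τ.mem = σ.mem ∧
      τ.reg 15 = b ^ s) := by
  refine Wp.seq (K₁ := 2) (K₂ := 28) (Wp.setReg (by simp [Expr.cost]) ?_) le_rfl
  have hF : Frame 14 σ ⟨Function.update σ.reg 15 (Expr.eval σ (.const 1)), σ.mem⟩ :=
    (Frame.refl _ _).update (by norm_num) _ _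
  refine (Wp.forReg (K := 14) (K' := 28) (e := 0) (N := s)
    (fun j τ => τ.mem = σ.mem ∧ τ.reg 15 = b ^ j)
    (by norm_num) (by simpa using hs) hsZ (by norm_num) ?_ ?_).mono le_rfl le_rfl ?_
  · simp [Expr.eval]
  · rintro j _ τ _ _ ⟨hm, h15⟩
    refine Wp.setReg (by omega) ⟨(Frame.refl _ _).update (by norm_num) _ _, hm, ?_⟩
    simp [hV, h15]; ring
  · rintro τ ⟨hFτ, h⟩
    exact ⟨hF.trans hFτ, h⟩

/-- Sets up the layout for the search for `s = g + 2 * r` elements, where the registers `1` and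
`3` hold `g` and `r`. -/
def setupProg : Prog :=
  .seq (.setReg 5 (.add (.reg 1) (.add (.reg 3) (.reg 3))))
  (.seq (powProg (.add (.reg 15) (.reg 15)))
  (.seq (.setReg 6 (.reg 15))
  (.seq (powProg (.add (.add (.reg 15) (.reg 15)) (.add (.reg 15) (.reg 15))))
  (.seq (.setReg 7 (.reg 15))
  (.seq (.setReg 8 (.reg 0))
  (.seq (.setReg 9 (.add (.reg 8) (.reg 7)))
  (.seq (.setReg 10 (.add (.reg 9) (.reg 7)))
  (.seq (.setReg 11 (.add (.reg 10) (.reg 7)))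
  (.seq (.setReg 12 (.add (.reg 11) (.reg 7)))
  (.setReg 13 (.add (.reg 12) (.reg 7))))))))))))

theorem Wp.setupProg {g r : ℕ} (hn : σ.reg 0 = l.length) (hg : σ.reg 1 = g) (hr : σ.reg 3 = r)
    (hin : ∀ j : ℕ, j < l.length → σ.mem j = l.getD j 0) (hs : g + 2 * r ≤ Z + 1) :
    Wp Z 200 1 RAM.setupProg σ (fun τ => Frame 5 σ τ ∧ ∃ f, Layout l (g + 2 * r) f τ) := by
  refine Wp.seq (K₁ := 10) (K₂ := 190) (Wp.setReg (by simp [Expr.cost]) ?_) le_rfl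
  set τ₁ : State := ⟨Function.update σ.reg 5
    (Expr.eval σ (.add (.reg 1) (.add (.reg 3) (.reg 3)))), σ.mem⟩ with hτ₁
  have hF₁ : Frame 5 σ τ₁ := (Frame.refl _ _).update le_rfl _ _
  have h5 : τ₁.reg 5 = (g + 2 * r : ℕ) := by simp [hτ₁, Expr.eval, hg, hr]; ring
  refine Wp.seq (K₁ := 30) (K₂ := 160) ((Wp.powProg (b := 2) h5 hs (by simp [Expr.cost])
    (fun τ => by simp [Expr.eval]; ring)).mono le_rfl le_rfl ?_) le_rfl
  rintro τ₂ ⟨hF₂, hm₂, h15⟩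
  refine Wp.seq (K₁ := 10) (K₂ := 150) (Wp.setReg (by simp [Expr.cost]) ?_) le_rfl
  set τ₃ : State := ⟨Function.update τ₂.reg 6 (Expr.eval τ₂ (.reg 15)), τ₂.mem⟩ with hτ₃
  have hF₃ : Frame 6 τ₁ τ₃ := (hF₂.mono (by norm_num)).update le_rfl _ _
  have h6 : τ₃.reg 6 = 2 ^ (g + 2 * r) := by simp [hτ₃, Expr.eval, h15]
  -- Quadrupling `s` times gives the array length `4 ^ s = 2 ^ (2 * s)`, by additions only.
  refine Wp.seq (K₁ := 30) (K₂ := 120) ((Wp.powProg (b := 4)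
    ((hF₃ 5 (by norm_num)).trans h5) hs (by simp [Expr.cost])
    (fun τ => by simp [Expr.eval]; ring)).mono le_rfl le_rfl ?_) le_rfl
  rintro τ₄ ⟨hF₄, hm₄, h15'⟩
  have hM : τ₄.reg 15 = ((2 ^ (2 * (g + 2 * r)) : ℕ) : ℤ) := by
    rw [h15', pow_mul]; push_cast; rfl
  have hlow : Frame 5 σ τ₄ :=
    (hF₁.trans (hF₃.mono (by norm_num))).trans (hF₄.mono (by norm_num))
  have h0 := (hlow 0 (by norm_num)).trans hn
  have h5' : τ₄.reg 5 = (g + 2 * r : ℕ) :=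
    (hF₄ 5 (by norm_num)).trans ((hF₃ 5 (by norm_num)).trans h5)
  have h6' := (hF₄ 6 (by norm_num)).trans h6
  have hmem : τ₄.mem = σ.mem := hm₄.trans hm₂
  generalize hMdef : 2 ^ (2 * (g + 2 * r)) = M at hM
  refine Wp.seq (K₁ := 10) (K₂ := 110) (Wp.setReg (by simp [Expr.cost]) ?_) le_rfl
  refine Wp.seq (K₁ := 10) (K₂ := 100) (Wp.setReg (by simp [Expr.cost]) ?_) le_rfl
  refine Wp.seq (K₁ := 10) (K₂ := 90) (Wp.setReg (by simp [Expr.cost]) ?_) le_rfl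
  refine Wp.seq (K₁ := 10) (K₂ := 80) (Wp.setReg (by simp [Expr.cost]) ?_) le_rfl
  refine Wp.seq (K₁ := 10) (K₂ := 70) (Wp.setReg (by simp [Expr.cost]) ?_) le_rfl
  refine Wp.seq (K₁ := 10) (K₂ := 60) (Wp.setReg (by simp [Expr.cost]) ?_) le_rfl
  refine Wp.setReg (by simp [Expr.cost]) ?_
  refine ⟨fun i hi => ?_, fun q m => σ.mem (l.length + q * M + m), ?_⟩
  · rw [← hlow i hi]
    simp [show i ≠ 7 by omega, show i ≠ 8 by omega, show i ≠ 9 by omega, show i ≠ 10 by omega,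
      show i ≠ 11 by omega, show i ≠ 12 by omega, show i ≠ 13 by omega]
  · refine ⟨by simp [h0], by simpa using h5', by simpa using h6', by simp [Expr.eval, hM, hMdef],
      ?_, fun j hj => by simpa [hmem] using hin j hj, fun q m _ _ => by simp [hmem, ← hMdef]⟩
    intro q hq
    rw [hMdef]
    interval_cases q <;> simp [Expr.eval, h0, hM] <;> ring

/-- Sets register `4` to `1` if some list with `s` distinct entries is found. -/
def searchProg : Prog :=
  .seq setupProg (.seq (mapArr 0 (.const 0)) (.seq (aset 0 (.const 0) (.const 1))
    (.seq (forReg 14 3 extendProg)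
      (.ite (aget 0 (.sub (.reg 7) (.const 1))) (.setReg 4 (.const 1)) .skip))))

open Classical in
theorem Wp.searchProg {g r : ℕ} (hl : l.Nodup) (hn : σ.reg 0 = l.length) (hg : σ.reg 1 = g)
    (hr : σ.reg 3 = r) (hin : ∀ j : ℕ, j < l.length → σ.mem j = l.getD j 0)
    (hnZ : l.length ≤ Z + 1) (hrZ : r ≤ Z + 1) (hZ : 2 ^ (2 * (g + 2 * r)) ≤ Z + 1) :
    Wp Z 1600 7 RAM.searchProg σ (fun τ => Frame 4 σ τ ∧
      (∀ j : ℕ, j < l.length → τ.mem j = l.getD j 0) ∧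
      τ.reg 4 = if ∃ q ∈ (extend l)^[r] [[]], q.Nodup ∧ q.length = g + 2 * r then 1
        else σ.reg 4) := by
  have hs : g + 2 * r ≤ Z + 1 := by
    have := (Nat.lt_two_pow_self (n := 2 * (g + 2 * r))).le
    omega
  have hMpos : 0 < 2 ^ (2 * (g + 2 * r)) := by positivity
  refine Wp.seq (K₁ := 200) (K₂ := 1400)
    ((Wp.setupProg hn hg hr hin hs).mono le_rfl (by norm_num) ?_) le_rfl
  rintro τ₁ ⟨hF₁, f, hy₁⟩
  refine Wp.seq (K₁ := 40) (K₂ := 1360) ((Wp.mapArr (fun _ => 0) hy₁ (by norm_num) hZ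
    (by simp [Expr.cost]) (by intros; rfl)).mono le_rfl (by norm_num) ?_) le_rfl
  rintro τ₂ ⟨hF₂, hy₂⟩
  refine Wp.seq (K₁ := 20) (K₂ := 1340) (Wp.aset (m := 0) (v := 1) hy₂ (by norm_num)
    (by simp [Expr.eval]) hMpos (by simp [Expr.eval]) (by simp [Expr.cost]) fun μ hμ => ?_) le_rfl
  have hF : Frame 5 σ ⟨τ₂.reg, μ⟩ := (hF₁.trans (hF₂.mono (by norm_num))).mem μ
  refine Wp.seq (K₁ := 1300) (K₂ := 40) ((Wp.forReg (K := 1200) (K' := 1300) (e := 6) (N := r)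
    (fun t τ => ∃ f', Layout l (g + 2 * r) f' τ ∧
      Represents (g + 2 * r) f' 0 ((extend l)^[t] [[]]))
    (by norm_num) ((hF 3 (by norm_num)).trans hr) hrZ (by norm_num) ?_ ?_).mono
      le_rfl le_rfl ?_) le_rfl
  -- The array with a single 1 at index 0 represents the formal sum `[[]]` from which the extensions
  -- start.
  · refine ⟨_, hμ.update_reg (by norm_num) _, fun m hm => ?_⟩
    rw [Function.iterate_zero, id, value_nil_singleton hm]
    by_cases h0 : m = 0 <;> simp [h0]
  · rintro t _ τ _ hτ ⟨f', hy, hf⟩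
    refine (Wp.extendProg hl hy hnZ hZ hf).mono le_rfl le_rfl ?_
    rintro ρ ⟨hFρ, f'', hy', hf'⟩
    refine ⟨hFρ, f'', hy'.update_reg (by norm_num) _, ?_⟩
    rwa [Function.iterate_succ_apply']
  · rintro τ₃ ⟨hF₃, f', hy₃, hf⟩
    have hF' : Frame 5 σ τ₃ := hF.trans (hF₃.mono (by norm_num))
    have hev := hy₃.eval_aget (q := 0) (m := 2 ^ (2 * (g + 2 * r)) - 1)
      (E := .sub (.reg 7) (.const 1)) (by norm_num)
      (by simp only [Expr.eval, hy₃.size]; push_cast [hMpos]; simp) (by omega)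
    rw [hf _ (by omega)] at hev
    refine Wp.ite (K := 10) (by simp [Expr.cost, aget]) (fun hpos => ?_) fun hneg => ?_
    · rw [hev, value_full] at hpos
      refine Wp.setReg (by simp [Expr.cost])
        ⟨(hF'.mono (by norm_num)).update le_rfl _ _, hy₃.input, ?_⟩
      rw [if_pos hpos]; simp [Expr.eval]
    · rw [hev, ← not_lt, value_full] at hneg
      refine Wp.skip (by norm_num) ⟨hF'.mono (by norm_num), hy₃.input, ?_⟩
      rw [if_neg hneg, hF' 4 (by norm_num)]

/-- The decision procedure. -/
def coverProg : Prog :=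
  .seq (.setReg 15 (.const 0))
  (.seq (forReg 14 0 (.setReg 15 (.sub (.const 1) (.reg 15))))
  (.seq (.setReg 1 (.add (.add (.reg 1) (.reg 1)) (.reg 15)))
  (.seq (.setReg 2 (.add (.reg 1) (.const 1)))
  (.seq (.setReg 4 (.const 0))
  (.seq (forReg 3 2 searchProg)
    (.setReg 0 (.reg 4)))))))

-- In the loop `r ≤ g ≤ 2k + 1`, so `2 * (g + 2 * r) ≤ 6 * g ≤ 12 * k + 6`: this is the exponent
-- that bounds the array length.
open Classical in
theorem Wp.coverProg {k : ℕ} (hl : l.Nodup) (hn : l.length ≤ Z + 1)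
    (hZ : 2 ^ (12 * k + 6) ≤ Z + 1) :
    Wp Z 1800 8 RAM.coverProg (init l k) (fun τ => τ.reg 0 =
      if ∃ r < 2 * k + l.length % 2 + 1, ∃ q ∈ (extend l)^[r] [[]],
        q.Nodup ∧ q.length = 2 * k + l.length % 2 + 2 * r then 1 else 0) := by
  refine Wp.seq (K₁ := 10) (K₂ := 1790) (Wp.setReg (by simp [Expr.cost]) ?_) le_rfl
  have hin : ∀ j : ℕ, j < l.length → (init l k).mem j = l.getD j 0 := fun j _ => by
    simp [init]
  -- In the absence of division, the parity of the length is found by toggling register `15` once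
  -- for each element.
  refine Wp.seq (K₁ := 30) (K₂ := 1760) ((Wp.forReg (K := 10) (K' := 30) (e := 0)
    (N := l.length) (fun j τ => τ.mem = (init l k).mem ∧ τ.reg 15 = ((j % 2 : ℕ) : ℤ))
    (by norm_num) (by simp [init]) hn (by norm_num) ?_ ?_).mono le_rfl (by norm_num) ?_) le_rfl
  · simp [Expr.eval]
  · rintro j _ τ _ _ ⟨hm, h15⟩
    refine Wp.setReg (by simp [Expr.cost])
      ⟨(Frame.refl _ _).update le_rfl _ _, hm, ?_⟩
    simp only [Expr.eval, h15, Function.update_self, ne_eq, Nat.reduceEqDiff, not_false_eq_true,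
      Function.update_of_ne]
    omega
  rintro τ₁ ⟨hF₁, hm₁, h15⟩
  have h0 : τ₁.reg 0 = l.length := by rw [hF₁ 0 (by norm_num)]; simp [init]
  have h1 : τ₁.reg 1 = k := by rw [hF₁ 1 (by norm_num)]; simp [init]
  set g := 2 * k + l.length % 2 with hg
  have hgk : g ≤ 2 * k + 1 := by omega
  refine Wp.seq (K₁ := 10) (K₂ := 1750) (Wp.setReg (by simp [Expr.cost]) ?_) le_rfl
  refine Wp.seq (K₁ := 10) (K₂ := 1740) (Wp.setReg (by simp [Expr.cost]) ?_) le_rfl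
  refine Wp.seq (K₁ := 10) (K₂ := 1730) (Wp.setReg (by simp [Expr.cost]) ?_) le_rfl
  have hgval : Expr.eval τ₁ (.add (.add (.reg 1) (.reg 1)) (.reg 15)) = g := by
    simp only [Expr.eval, h1, h15, hg]; push_cast; ring
  rw [hgval]
  set τ₂ : State := ⟨Function.update (Function.update (Function.update τ₁.reg 1 (g : ℤ)) 2
    (Expr.eval ⟨Function.update τ₁.reg 1 (g : ℤ), τ₁.mem⟩ (.add (.reg 1) (.const 1)))) 4
    (Expr.eval ⟨Function.update (Function.update τ₁.reg 1 (g : ℤ)) 2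
      (Expr.eval ⟨Function.update τ₁.reg 1 (g : ℤ), τ₁.mem⟩ (.add (.reg 1) (.const 1))),
        τ₁.mem⟩ (.const 0)), τ₁.mem⟩ with hτ₂
  have hsmall : 12 * k + 6 < 2 ^ (12 * k + 6) := Nat.lt_two_pow_self
  refine Wp.seq (K₁ := 1700) (K₂ := 30) ((Wp.forReg (K := 1600) (K' := 1700) (e := 7)
    (N := g + 1) (fun t τ => (∀ j : ℕ, j < l.length → τ.mem j = l.getD j 0) ∧
      τ.reg 4 = if ∃ r < t, ∃ q ∈ (extend l)^[r] [[]], q.Nodup ∧ q.length = g + 2 * r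
        then 1 else 0)
    (by norm_num) (by simp [hτ₂, Expr.eval]) (by omega) (by norm_num) ?_ ?_).mono
      le_rfl le_rfl ?_) le_rfl
  · exact ⟨fun j hj => by simpa [hτ₂, hm₁] using hin j hj, by simp [hτ₂, Expr.eval]⟩
  · rintro r hr τ hF hτ ⟨hm, h4⟩
    refine (Wp.searchProg (g := g) hl ((hF 0 (by norm_num)).trans (by simp [hτ₂, h0]))
      ((hF 1 (by norm_num)).trans (by simp [hτ₂])) hτ hm hn (by omega)
      ((Nat.pow_le_pow_right (by norm_num) (by omega)).trans hZ)).mono le_rfl le_rfl ?_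
    rintro ρ ⟨hFρ, hmρ, h4ρ⟩
    refine ⟨hFρ, hmρ, ?_⟩
    dsimp only
    rw [Function.update_of_ne (by norm_num), h4ρ, h4]
    simp only [Nat.lt_succ_iff_lt_or_eq, or_and_right, exists_or, exists_eq_left]
    by_cases hA : ∃ q ∈ (extend l)^[r] [[]], q.Nodup ∧ q.length = g + 2 * r
    · rw [if_pos hA, if_pos (.inr hA)]
    · simp only [hA, if_false, or_false]
  · rintro τ ⟨-, -, h4⟩
    refine Wp.setReg (by simp [Expr.cost]) ?_
    simpa [Expr.eval] using h4

end RAM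

/-! ### The time bound -/

theorem exists_time_bound (K e : ℕ) : ∃ c : ℕ, ∀ n k : ℕ,
    K * ((n + 1) * 2 ^ (12 * k + 7)) ^ e ≤ c * 2 ^ (c * k) * (n + 1) ^ c := by
  -- One constant serves in three places: it dominates the factor `K * 2 ^ (7 * e)`, the coefficient
  -- `12 * e` of `k`, and the exponent `e` of `n + 1`.
  refine ⟨K * 2 ^ (7 * e) + 12 * e, fun n k => ?_⟩
  set c := K * 2 ^ (7 * e) + 12 * e with hc
  have h1 : K * ((n + 1) * 2 ^ (12 * k + 7)) ^ e =
      K * 2 ^ (7 * e) * 2 ^ (12 * e * k) * (n + 1) ^ e := by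
    rw [mul_pow, ← pow_mul, show (12 * k + 7) * e = 7 * e + 12 * e * k by ring, pow_add]
    ring
  rw [h1]
  refine Nat.mul_le_mul (Nat.mul_le_mul (by omega) ?_) ?_
  · exact Nat.pow_le_pow_right (by norm_num) (Nat.mul_le_mul_right _ (by omega))
  · exact Nat.pow_le_pow_right (by omega) (by omega)

theorem theorem4 :
    ∃ (p : RAM.Prog) (c : ℕ), ∀ (X : Finset ℤ) (k : ℕ) (l : List ℤ),
      l.Nodup → l.toFinset = X →
      ∃ (T : ℕ) (τ : RAM.State),
        RAM.Runs p (RAM.init l k) T τ ∧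
        T ≤ c * 2 ^ (c * k) * (X.card + 1) ^ c ∧
        (CoverableBelow X k → τ.reg 0 = 1) ∧
        (¬ CoverableBelow X k → τ.reg 0 = 0) := by
  classical
  obtain ⟨c, hc⟩ := exists_time_bound 1800 8
  refine ⟨RAM.coverProg, c, fun X k l hl hX => ?_⟩
  have hcard : X.card = l.length := by rw [← hX, List.toFinset_card_of_nodup hl]
  have hpos : 0 < (l.length + 1) * 2 ^ (12 * k + 7) := by positivity
  have hZ : (l.length + 1) * 2 ^ (12 * k + 7) - 1 + 1 = (l.length + 1) * 2 ^ (12 * k + 7) := by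
    omega
  have h2 : 0 < 2 ^ (12 * k + 7) := by positivity
  -- `Z + 1 = (n + 1) * 2 ^ (12 * k + 7)` dominates both kinds of loop length, that of the input
  -- list and that of the arrays.
  obtain ⟨T, τ, hrun, hT, hτ⟩ := RAM.Wp.coverProg
    (Z := (l.length + 1) * 2 ^ (12 * k + 7) - 1) (k := k) hl
    (by rw [hZ]; exact (Nat.le_succ _).trans (Nat.le_mul_of_pos_right _ h2))
    (by
      rw [hZ]
      exact (Nat.pow_le_pow_right (by norm_num) (by omega)).trans
        (Nat.le_mul_of_pos_left _ (by omega)))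
  refine ⟨T, τ, hrun, ?_, fun h => ?_, fun h => ?_⟩
  · rw [hZ] at hT
    rw [hcard]
    exact hT.trans (hc _ _)
  · rw [hτ, if_pos ((coverableBelow_iff hl hX k).mp h)]
  · rw [hτ, if_neg (mt (coverableBelow_iff hl hX k).mpr h)]
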